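/- **Theorem (weak consistency of higher-order spectral clustering).** Let $\mathbf T^d=\mathbb R^d/\mathbb Z^d$ be the flat torus with the norm $\|x\|=\max_i |x_i|$ (coordinates represented in $[-\frac12,\frac12]$), and let $F_{\rm in},F_{\rm out}:\mathbf T^d\to[0,1]$ be measurable functions such that $F_{\rm in}(x)$ and $F_{\rm out}(x)$ depend only on $\|x\|$. Write $\widehat F(k)=\int_{\mathbf T^d}F(x)e^{-2i\pi\langle k,x\rangle}\,dx$ for $k\in\mathbb Z^d$, and $\mu_{\rm in}=\int_{\mathbf T^d} F_{\rm in}$, $\mu_{\rm out}=\int_{\mathbf T^d} F_{\rm out}$. For even $n$, the soft geometric block model (SGBM) on the nodes $[n]=\{1,\dots,n\}$ is defined as follows. The labelling $\sigma:[n]\to\{1,2\}$ is uniform among the labellings with exactly $n/2$ nodes of each label; the positions $X_1,\dots,X_n$ are independent, uniform on $\mathbf T^d$, and independent of $\sigma$; given $\sigma$ and $X$, the pairs $i<j$ are joined by an edge independently, with probability $F_{\rm in}(X_i-X_j)$ if $\sigma_i=\sigma_j$ and $F_{\rm out}(X_i-X_j)$ otherwise. Let $A$ be the adjacency matrix of the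 resulting graph. Algorithm HOSC, given $A$, $\mu_{\rm in}$, $\mu_{\rm out}$, takes an eigenvalue $\widetilde\lambda$ of $A$ closest to $\lambda_*=\frac{\mu_{\rm in}-\mu_{\rm out}}2\,n$ and an eigenvector $\widetilde v\neq0$ of $A$ for $\widetilde\lambda$, and returns the labelling $\widetilde\sigma$ with $\widetilde\sigma_i=1$ if $\widetilde v_i>0$ and $\widetilde\sigma_i=2$ otherwise. The choices of $\widetilde\lambda$ (in case of a tie) and of $\widetilde v$ are arbitrary functions of $A$. The number of misclassified nodes is $r_n=\min_{\pi}\#\{i\in[n]:\sigma_i\neq\pi(\widetilde\sigma_i)\}$, where $\pi$ ranges over the permutations of $\{1,2\}$. Assume that $\mu_{\rm in}\neq\mu_{\rm out}$ and $$\widehat F_{\rm in}(k)+\widehat F_{\rm out}(k)\neq\mu_{\rm in}-\mu_{\rm out}\quad\text{for all }k\in\mathbb Z^d,\qquad \widehat F_{\rm in}(k)-\widehat F_{\rm out}(k)\neq\mu_{\rm in}-\mu_{\rm out}\quad\text{for all }k\in\mathbb Z^d\setminus\{0\}.$$ Then HOSC is weakly consistent: for every $\varepsilon>0$, $\Pr(r_n/n>\varepsilon)\to0$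 as $n\to\infty$ along the even integers. More precisely, HOSC misclassifies at most $O(\log n)$ nodes with high probability: there is a constant $C>0$, depending only on $d,F_{\rm in},F_{\rm out}$, such that, whatever choices the algorithm makes, $\Pr(r_n\le C\log n)\to1$ as $n\to\infty$ along the even integers. -/

import Mathlib

open MeasureTheory Filter Topology
open scoped ENNReal

noncomputable section

namespace GeometricBlockModel

/-- A connectivity probability function on the flat torus `𝐓^d = ℝ^d / ℤ^d`: a measurable function
with values in `[0, 1]` that depends only on the norm. The norm of `UnitAddTorus (Fin d)` is the
supremum over the coordinates of the distance of the coordinate to `0` in `ℝ / ℤ`. -/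
structure ConnectivityFunction (d : ℕ) where
  toFun : UnitAddTorus (Fin d) → ℝ
  measurable : Measurable toFun
  nonneg : ∀ x, 0 ≤ toFun x
  le_one : ∀ x, toFun x ≤ 1
  radial : ∀ x y, ‖x‖ = ‖y‖ → toFun x = toFun y

/-- The uniform probability measure on the torus. -/
def uniformTorus (d : ℕ) : Measure (UnitAddTorus (Fin d)) :=
  Measure.pi fun _ => (AddCircle.haarAddCircle : Measure UnitAddCircle)

instance (d : ℕ) : IsProbabilityMeasure (uniformTorus d) := by
  unfold uniformTorus
  infer_instance

/-- The Fourier coefficient `∫ F(x) exp (-2 i π ⟨k, x⟩) dx`. -/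
def ConnectivityFunction.fourierCoeff {d : ℕ} (F : ConnectivityFunction d) (k : Fin d → ℤ) : ℂ :=
  UnitAddTorus.mFourierCoeff (fun x => (F.toFun x : ℂ)) k

/-- The edge density `∫ F(x) dx`. -/
def ConnectivityFunction.density {d : ℕ} (F : ConnectivityFunction d) : ℝ :=
  ∫ x, F.toFun x ∂uniformTorus d

/-- A node labelling of `n` nodes by two labels. -/
abbrev Labelling (n : ℕ) : Type := Fin n → Fin 2

/-- The labellings with two blocks of equal size `n / 2` (there are none if `n` is odd). -/
def balancedLabellings (n : ℕ) : Set (Labelling n) :=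
  {σ | 2 * (Finset.univ.filter fun i => σ i = 0).card = n ∧
    2 * (Finset.univ.filter fun i => σ i = 1).card = n}

/-- A sample of the model: labels, positions, graph. -/
abbrev Sample (d n : ℕ) : Type :=
  Labelling n × (Fin n → UnitAddTorus (Fin d)) × SimpleGraph (Fin n)

section Model

variable {d : ℕ} (FIn FOut : ConnectivityFunction d)

/-- The probability of an edge between two nodes with position difference `x` and labels `s, t`. -/
def edgeProb (x : UnitAddTorus (Fin d)) (s t : Fin 2) : ℝ :=
  if s = t then FIn.toFun x else FOut.toFun x

open Classical in
/-- The conditional probability of the graph `G` given the labels `σ` and the positions `X`: edges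
are drawn independently over the pairs `i < j`. -/
def graphProb {n : ℕ} (σ : Labelling n) (X : Fin n → UnitAddTorus (Fin d))
    (G : SimpleGraph (Fin n)) : ℝ :=
  ∏ i, ∏ j ∈ Finset.Ioi i,
    if G.Adj i j then edgeProb FIn FOut (X i - X j) (σ i) (σ j)
    else 1 - edgeProb FIn FOut (X i - X j) (σ i) (σ j)

/-- The joint law of labels, positions and graph in the soft geometric block model on `n` nodes:
the labelling is uniform over all balanced ones, the positions are independent of it and
independent uniform on the torus, and, given both, the graph has probability `graphProb`. -/
def sgbm (n : ℕ) : Measure (Sample d n) :=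
  ((ProbabilityTheory.uniformOn (balancedLabellings n)).prod
    ((Measure.pi fun _ : Fin n => uniformTorus d).prod Measure.count)).withDensity
      fun ω => ENNReal.ofReal (graphProb FIn FOut ω.1 ω.2.1 ω.2.2)

end Model

/-- The number of nodes misclassified by `τ`, up to a global permutation of the labels. -/
def misclassified {n : ℕ} (σ τ : Labelling n) : ℕ :=
  ⨅ π : Equiv.Perm (Fin 2), (Finset.univ.filter fun i => σ i ≠ π (τ i)).card

/-- The ratio of misclassified nodes. -/
def loss {n : ℕ} (σ τ : Labelling n) : ℝ := (misclassified σ τ : ℝ) / n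

open Classical in
/-- `τ` is an output of higher-order spectral clustering on the graph `G` with densities `μin` and
`μout`: for an eigenvalue `lam` of the adjacency matrix closest to `n (μin - μout) / 2` and an
eigenvector `v` for it, node `i` has the first label iff `v i > 0`. (In case of ties, of a multiple
eigenvalue, and for the scaling of `v`, every choice is allowed.) -/
def IsHOSCOutput {n : ℕ} (μin μout : ℝ) (G : SimpleGraph (Fin n)) (τ : Labelling n) : Prop :=
  ∃ (lam : ℝ) (v : Fin n → ℝ),
    Module.End.HasEigenvector (Matrix.toLin' (G.adjMatrix ℝ)) lam v ∧
    (∀ lam', Module.End.HasEigenvalue (Matrix.toLin' (G.adjMatrix ℝ)) lam' →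
      |lam - (μin - μout) / 2 * n| ≤ |lam' - (μin - μout) / 2 * n|) ∧
    ∀ i, τ i = if 0 < v i then 0 else 1

/-- A clustering algorithm for graphs with an even number `2 * m` of nodes. -/
abbrev ClusteringAlgorithm : Type :=
  ∀ m : ℕ, SimpleGraph (Fin (2 * m)) → Labelling (2 * m)

/-- The algorithm is higher-order spectral clustering (on every non-empty graph). -/
def IsHOSC (μin μout : ℝ) (alg : ClusteringAlgorithm) : Prop :=
  ∀ m, 0 < m → ∀ G, IsHOSCOutput μin μout G (alg m G)

/-- Weak consistency: for every `ε > 0`, the probability that the ratio of misclassified nodes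
exceeds `ε` tends to `0` as the number of nodes `n = 2 * m` tends to infinity. -/
def WeaklyConsistent {d : ℕ} (FIn FOut : ConnectivityFunction d) (alg : ClusteringAlgorithm) :
    Prop :=
  ∀ ε : ℝ, 0 < ε →
    Tendsto (fun m : ℕ => sgbm FIn FOut (2 * m) {ω | ε < loss ω.1 (alg m ω.2.2)}) atTop (𝓝 0)

end GeometricBlockModel

end

noncomputable section

namespace GeometricBlockModel

open UnitAddTorus

/-! ### Fourier analysis on the torus and second moments of sums -/

section Torus

variable {d : ℕ}

/-! Let `s` be the sign vector of the true labels, `A` the adjacency matrix and `t = n (μin - μout)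
/ 2`. Two facts suffice. The vector `s` is almost an eigenvector: `‖(A - t) s‖² ≤ n² L` with `L =
log n`, outside an event of probability `O(1 / L)`. On the orthogonal complement of `s`, `A - t` is
bounded below by `κ = n c / 2`, where `c > 0` does not depend on `n`. The first fact puts an
eigenvalue of `A` within `√(n L)` of `t`. The two together force any eigenvector for the eigenvalue
closest to `t` to have only a fraction `O(L / n)` of its squared norm orthogonal to `s`, so rounding
errs on `O(L)` nodes. This is `misclassified_le_of_gap`. Simplicity of the eigenvalue is never
needed, and neither is a rule for ties.

For the lower bound (`adjMatrix_gap`), write `A = n K + M + Q`. Here `M` is `A` centered by its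
conditional mean, `K = U D Uᴴ` is built from finitely many Fourier modes at the node positions,
plain and multiplied by `s`, and `Q` is the error of truncating the Fourier series. The diagonal `D`
holds the numbers `(F̂in ± F̂out)(k) / 2`. They tend to `0`, so by the hypotheses they stay away
from `(μin - μout) / 2`, except for the mode `s` itself (`exists_gap`). The columns of `U` are
almost orthonormal, hence `K` inherits the gap (`mul_norm_le_norm_mulVec_sub`). `M` and `Q` are
small compared with `n`: the fourth power of `‖M‖` is at most the squared Frobenius norm of `M²`, of
mean `O(n³)`, and `‖Q‖²` has mean at most `n²` times the Fourier tail plus `O(n)`.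

All probabilistic input consists of second moments and Markov's inequality. The frequency set is
fixed before `n` tends to infinity, so that its tail error, the only contribution that does not
vanish with `n`, is as small as desired. -/

instance : (uniformTorus d).IsAddHaarMeasure := by
  unfold uniformTorus
  infer_instance

lemma ConnectivityFunction.fourierCoeff_eq_integral (F : ConnectivityFunction d)
    (k : Fin d → ℤ) :
    F.fourierCoeff k = ∫ x, mFourier (-k) x * (F.toFun x : ℂ) ∂uniformTorus d := rfl

lemma norm_mFourier_apply (k : Fin d → ℤ) (x : UnitAddTorus (Fin d)) : ‖mFourier k x‖ = 1 := by
  simp only [mFourier, fourier_apply, ContinuousMap.coe_mk, norm_prod, Circle.norm_coe,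
    Finset.prod_const_one]

lemma mFourier_apply_add (k : Fin d → ℤ) (x y : UnitAddTorus (Fin d)) :
    mFourier k (x + y) = mFourier k x * mFourier k y := by
  simp [mFourier, fourier_apply, Finset.prod_mul_distrib, smul_add, AddCircle.toCircle_add]

lemma mFourier_apply_neg (k : Fin d → ℤ) (x : UnitAddTorus (Fin d)) :
    mFourier k (-x) = starRingEnd ℂ (mFourier k x) := by
  rw [← mFourier_neg]
  simp [mFourier, fourier_apply]

lemma mFourier_apply_sub (k : Fin d → ℤ) (x y : UnitAddTorus (Fin d)) :
    mFourier k (x - y) = mFourier k x * starRingEnd ℂ (mFourier k y) := by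
  rw [sub_eq_add_neg, mFourier_apply_add, mFourier_apply_neg]

lemma integral_mFourier_of_ne_zero {k : Fin d → ℤ} (hk : k ≠ 0) :
    ∫ x, mFourier k x ∂uniformTorus d = 0 := by
  obtain ⟨i, hi⟩ := Function.ne_iff.mp hk
  have h : ∫ x, (fourier (k i) x : ℂ) ∂(AddCircle.haarAddCircle : Measure UnitAddCircle) = 0 := by
    have := orthonormal_iff_ite.mp (orthonormal_fourier (T := (1 : ℝ))) 0 (k i)
    rw [ContinuousMap.inner_toLp] at this
    simpa [Ne.symm (show k i ≠ 0 from hi)] using this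
  have := integral_fintype_prod_eq_prod (𝕜 := ℂ)
    (μ := fun _ : Fin d => (AddCircle.haarAddCircle : Measure UnitAddCircle))
    (fun i => (fourier (k i) : UnitAddCircle → ℂ))
  refine Eq.trans this ?_
  exact Finset.prod_eq_zero (Finset.mem_univ i) h

lemma ConnectivityFunction.norm_coe_le_one (F : ConnectivityFunction d)
    (x : UnitAddTorus (Fin d)) : ‖(F.toFun x : ℂ)‖ ≤ 1 := by
  rw [Complex.norm_real, Real.norm_of_nonneg (F.nonneg x)]
  exact F.le_one x

lemma ConnectivityFunction.measurable_coe (F : ConnectivityFunction d) :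
    Measurable fun x => (F.toFun x : ℂ) :=
  Complex.measurable_ofReal.comp F.measurable

lemma ConnectivityFunction.norm_fourierCoeff_le_one (F : ConnectivityFunction d)
    (k : Fin d → ℤ) : ‖F.fourierCoeff k‖ ≤ 1 := by
  rw [F.fourierCoeff_eq_integral]
  refine (norm_integral_le_of_norm_le_const (C := 1) (.of_forall fun x => ?_)).trans (by simp)
  rw [norm_mul, norm_mFourier_apply, one_mul]
  exact F.norm_coe_le_one x

lemma ConnectivityFunction.memLp (F : ConnectivityFunction d) :
    MemLp (fun x => (F.toFun x : ℂ)) 2 (uniformTorus d) :=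
  MemLp.of_bound F.measurable_coe.aestronglyMeasurable 1 (.of_forall F.norm_coe_le_one)

lemma ConnectivityFunction.mFourierCoeff_toLp (F : ConnectivityFunction d) (k : Fin d → ℤ) :
    mFourierCoeff (F.memLp.toLp _) k = F.fourierCoeff k := by
  refine integral_congr_ae (μ := uniformTorus d) ?_
  filter_upwards [F.memLp.coeFn_toLp] with x hx
  exact congrArg (fun z : ℂ => mFourier (-k) x • z) hx

/-- Riemann–Lebesgue through Parseval: `F` is bounded, hence square integrable, so the squared
coefficients are summable. -/
lemma ConnectivityFunction.tendsto_fourierCoeff (F : ConnectivityFunction d) :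
    Tendsto F.fourierCoeff cofinite (𝓝 0) := by
  have h : Tendsto (fun k => ‖mFourierCoeff (F.memLp.toLp _) k‖ ^ 2) cofinite (𝓝 0) :=
    (hasSum_sq_mFourierCoeff (F.memLp.toLp _)).summable.tendsto_cofinite_zero
  simp only [F.mFourierCoeff_toLp] at h
  rw [tendsto_zero_iff_norm_tendsto_zero]
  have := h.sqrt
  simpa [Real.sqrt_sq] using this

/-- The trigonometric polynomial with the Fourier coefficients of `F` on `S`. -/
def ConnectivityFunction.fourierSum (F : ConnectivityFunction d) (S : Finset (Fin d → ℤ)) :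
    C(UnitAddTorus (Fin d), ℂ) :=
  ∑ k ∈ S, F.fourierCoeff k • mFourier k

lemma ConnectivityFunction.fourierSum_apply (F : ConnectivityFunction d)
    (S : Finset (Fin d → ℤ)) (x : UnitAddTorus (Fin d)) :
    F.fourierSum S x = ∑ k ∈ S, F.fourierCoeff k * mFourier k x := by
  simp [fourierSum, ContinuousMap.sum_apply]

lemma ConnectivityFunction.norm_fourierSum_le (F : ConnectivityFunction d)
    (S : Finset (Fin d → ℤ)) (x : UnitAddTorus (Fin d)) : ‖F.fourierSum S x‖ ≤ S.card := by
  rw [fourierSum_apply]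
  refine (norm_sum_le _ _).trans ?_
  calc ∑ k ∈ S, ‖F.fourierCoeff k * mFourier k x‖ ≤ ∑ k ∈ S, 1 := by
        refine Finset.sum_le_sum fun k _ => ?_
        rw [norm_mul, norm_mFourier_apply, mul_one]
        exact F.norm_fourierCoeff_le_one k
    _ = S.card := by simp

lemma norm_sq_eq_integral_norm_sq {α : Type*} [MeasurableSpace α] {μ : Measure α}
    (g : Lp ℂ 2 μ) : ‖g‖ ^ 2 = ∫ x, ‖g x‖ ^ 2 ∂μ := by
  have h : ((‖g‖ ^ 2 : ℝ) : ℂ) = ((∫ x, ‖g x‖ ^ 2 ∂μ : ℝ) : ℂ) := by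
    have := inner_self_eq_norm_sq_to_K (𝕜 := ℂ) g
    rw [L2.inner_def] at this
    simp only [inner_self_eq_norm_sq_to_K] at this
    rw [← integral_complex_ofReal]
    push_cast
    exact this.symm
  exact_mod_cast h

lemma ConnectivityFunction.tendsto_integral_norm_sub_fourierSum (F : ConnectivityFunction d) :
    Tendsto (fun S => ∫ x, ‖(F.toFun x : ℂ) - F.fourierSum S x‖ ^ 2 ∂uniformTorus d)
      atTop (𝓝 0) := by
  have h : Tendsto (fun S : Finset (Fin d → ℤ) => ∑ k ∈ S, mFourierCoeff (F.memLp.toLp _) k •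
      ContinuousMap.toLp (E := ℂ) 2 (uniformTorus d) ℂ (mFourier k)) atTop
      (𝓝 (F.memLp.toLp _)) :=
    hasSum_mFourier_series_L2 (F.memLp.toLp _)
  have h2 := (tendsto_iff_norm_sub_tendsto_zero.mp h).pow 2
  rw [zero_pow two_ne_zero] at h2
  refine h2.congr fun S => ?_
  have hsum : ∑ k ∈ S, mFourierCoeff (F.memLp.toLp _) k •
      ContinuousMap.toLp (E := ℂ) 2 (uniformTorus d) ℂ (mFourier k) =
      ContinuousMap.toLp (E := ℂ) 2 (uniformTorus d) ℂ (F.fourierSum S) := by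
    simp only [fourierSum, map_sum, map_smul, F.mFourierCoeff_toLp]
  rw [hsum, norm_sq_eq_integral_norm_sq]
  refine integral_congr_ae ?_
  filter_upwards [Lp.coeFn_sub (ContinuousMap.toLp (E := ℂ) 2 (uniformTorus d) ℂ (F.fourierSum S))
    (F.memLp.toLp _), F.memLp.coeFn_toLp,
    ContinuousMap.coeFn_toLp (𝕜 := ℂ) (p := 2) (uniformTorus d) (F.fourierSum S)]
    with x h1 h2 h3
  rw [h1, Pi.sub_apply, h2, h3, norm_sub_rev]

/-- The shift of the coordinate `j` of a configuration `X` by `y`. -/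
def shift {n : ℕ} (j : Fin n) (y : UnitAddTorus (Fin d)) (X : Fin n → UnitAddTorus (Fin d)) :
    Fin n → UnitAddTorus (Fin d) :=
  Pi.single j y + X

lemma shift_apply_self {n : ℕ} (j : Fin n) (y : UnitAddTorus (Fin d))
    (X : Fin n → UnitAddTorus (Fin d)) : shift j y X j = y + X j := by
  simp [shift]

lemma shift_apply_of_ne {n : ℕ} {i j : Fin n} (h : i ≠ j) (y : UnitAddTorus (Fin d))
    (X : Fin n → UnitAddTorus (Fin d)) : shift j y X i = X i := by
  simp [shift, h]

variable (d) in
/-- The law of `n` independent uniform positions. -/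
def positions (n : ℕ) : Measure (Fin n → UnitAddTorus (Fin d)) :=
  Measure.pi fun _ : Fin n => uniformTorus d

instance (n : ℕ) : IsProbabilityMeasure (positions d n) := by
  unfold positions
  infer_instance

instance (n : ℕ) : (positions d n).IsAddLeftInvariant := by
  unfold positions
  infer_instance

variable {E : Type*} [NormedAddCommGroup E] [NormedSpace ℝ E] [CompleteSpace E]

/-- Averaging a bounded function over the shifts of one coordinate does not change its
integral. -/
lemma integral_integral_shift {n : ℕ} (j : Fin n) {H : (Fin n → UnitAddTorus (Fin d)) → E}
    (hH : StronglyMeasurable H) {B : ℝ} (hB : ∀ X, ‖H X‖ ≤ B) :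
    ∫ X, ∫ y, H (shift j y X) ∂uniformTorus d ∂positions d n = ∫ X, H X ∂positions d n := by
  have hm : Measurable fun p : (Fin n → UnitAddTorus (Fin d)) × UnitAddTorus (Fin d) =>
      shift j p.2 p.1 := by
    unfold shift
    refine Measurable.add ?_ measurable_fst
    refine measurable_pi_lambda _ fun i => ?_
    by_cases h : i = j
    · subst h
      simpa using measurable_snd
    · simp [h]
  rw [integral_integral_swap]
  · have : ∀ y, ∫ X, H (shift j y X) ∂positions d n = ∫ X, H X ∂positions d n := fun y =>
      integral_add_left_eq_self (μ := positions d n) H (Pi.single j y)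
    simp [this]
  · exact Integrable.of_bound (hH.comp_measurable hm).aestronglyMeasurable B
      (.of_forall fun p => hB _)

/-- Pairwise orthogonal bounded random vectors satisfy the Pythagorean theorem in mean. -/
lemma integral_norm_sq_sum_le {α F ι : Type*} [MeasurableSpace α] {μ : Measure α}
    [IsProbabilityMeasure μ] [NormedAddCommGroup F] [InnerProductSpace ℝ F]
    (s : Finset ι) {f : ι → α → F} (hf : ∀ i ∈ s, StronglyMeasurable (f i))
    (hb : ∀ i ∈ s, ∀ x, ‖f i x‖ ≤ 1)
    (ho : ∀ i ∈ s, ∀ j ∈ s, i ≠ j → ∫ x, inner ℝ (f i x) (f j x) ∂μ = 0) :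
    ∫ x, ‖∑ i ∈ s, f i x‖ ^ 2 ∂μ ≤ s.card := by
  have hint : ∀ i ∈ s, ∀ j ∈ s, Integrable (fun x => inner ℝ (f i x) (f j x)) μ := by
    intro i hi j hj
    refine Integrable.of_bound ((hf i hi).inner (hf j hj)).aestronglyMeasurable 1
      (.of_forall fun x => ?_)
    exact (norm_inner_le_norm _ _).trans (mul_le_one₀ (hb i hi x) (norm_nonneg _) (hb j hj x))
  have hpt : ∀ x, ‖∑ i ∈ s, f i x‖ ^ 2 = ∑ i ∈ s, ∑ j ∈ s, inner ℝ (f i x) (f j x) := by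
    intro x
    rw [← real_inner_self_eq_norm_sq, sum_inner]
    simp_rw [inner_sum]
  simp_rw [hpt]
  rw [integral_finsetSum _ fun i hi => integrable_finsetSum _ fun j hj => hint i hi j hj]
  have : ∀ i ∈ s, ∫ x, ∑ j ∈ s, inner ℝ (f i x) (f j x) ∂μ ≤ 1 := by
    intro i hi
    rw [integral_finsetSum _ fun j hj => hint i hi j hj, Finset.sum_eq_single_of_mem i hi]
    · refine (integral_mono (hint i hi i hi) (integrable_const 1) fun x => ?_).trans (by simp)
      rw [real_inner_self_eq_norm_sq]
      exact pow_le_one₀ (norm_nonneg _) (hb i hi x)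
    · exact fun j hj hji => ho i hi j hj hji.symm
  simpa using Finset.sum_le_sum this

/-- The second moment of a sum of bounded random vectors, each of which averages to `0` over the
shifts of a coordinate that does not enter the other ones. -/
lemma integral_norm_sq_sum_le_of_shift {F : Type*} [NormedAddCommGroup F]
    [InnerProductSpace ℝ F] [CompleteSpace F] {n : ℕ} (s : Finset (Fin n))
    {f : Fin n → (Fin n → UnitAddTorus (Fin d)) → F}
    (hf : ∀ i ∈ s, StronglyMeasurable (f i)) (hb : ∀ i ∈ s, ∀ X, ‖f i X‖ ≤ 1)
    (hinv : ∀ i ∈ s, ∀ j ∈ s, i ≠ j → ∀ X y, f i (shift j y X) = f i X)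
    (hzero : ∀ j ∈ s, ∀ X, ∫ y, f j (shift j y X) ∂uniformTorus d = 0)
    (hint : ∀ j ∈ s, ∀ X, Integrable (fun y => f j (shift j y X)) (uniformTorus d)) :
    ∫ X, ‖∑ i ∈ s, f i X‖ ^ 2 ∂positions d n ≤ s.card := by
  refine integral_norm_sq_sum_le s hf hb fun i hi j hj hij => ?_
  -- Averaging over shifts of coordinate `j` leaves the factor `f i` fixed and kills `f j`.
  rw [← integral_integral_shift j ((hf i hi).inner (hf j hj)) (B := 1)]
  · simp_rw [hinv i hi j hj hij]
    simp [integral_inner (hint j hj _), hzero j hj]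
  · intro X
    exact (norm_inner_le_norm _ _).trans (mul_le_one₀ (hb i hi X) (norm_nonneg _) (hb j hj X))

end Torus

/-! ### Averages over the random positions -/

section Positions

variable {d : ℕ}

lemma ConnectivityFunction.toFun_neg (F : ConnectivityFunction d) (x : UnitAddTorus (Fin d)) :
    F.toFun (-x) = F.toFun x :=
  F.radial _ _ (norm_neg x)

lemma ConnectivityFunction.integrable (F : ConnectivityFunction d) :
    Integrable F.toFun (uniformTorus d) :=
  Integrable.of_bound F.measurable.aestronglyMeasurable 1 (.of_forall fun x => by
    rw [Real.norm_of_nonneg (F.nonneg x)]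
    exact F.le_one x)

lemma ConnectivityFunction.density_nonneg (F : ConnectivityFunction d) : 0 ≤ F.density :=
  integral_nonneg F.nonneg

lemma ConnectivityFunction.density_le_one (F : ConnectivityFunction d) : F.density ≤ 1 := by
  refine (integral_mono F.integrable (integrable_const 1) F.le_one).trans (by simp)

/-- The connectivity function for a pair of nodes with given labels. -/
def labelled (FIn FOut : ConnectivityFunction d) (s t : Fin 2) : ConnectivityFunction d :=
  if s = t then FIn else FOut

lemma edgeProb_eq (FIn FOut : ConnectivityFunction d) (x : UnitAddTorus (Fin d)) (s t : Fin 2) :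
    edgeProb FIn FOut x s t = (labelled FIn FOut s t).toFun x := by
  unfold edgeProb labelled
  split_ifs <;> rfl

lemma labelled_comm (FIn FOut : ConnectivityFunction d) (s t : Fin 2) :
    labelled FIn FOut s t = labelled FIn FOut t s := by
  simp [labelled, eq_comm]

/-- A nonconstant character has mean zero, so the terms are orthogonal and the second moment is
linear in `n`. This controls inner products of modes with different frequencies. -/
lemma integral_norm_sq_sum_mFourier_le {n : ℕ} {k : Fin d → ℤ} (hk : k ≠ 0) {a : Fin n → ℝ}
    (ha : ∀ i, |a i| ≤ 1) :
    ∫ X, ‖∑ i, (a i : ℂ) * mFourier k (X i)‖ ^ 2 ∂positions d n ≤ n := by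
  have h := integral_norm_sq_sum_le_of_shift (d := d) (F := ℂ) (Finset.univ : Finset (Fin n))
    (f := fun i X => (a i : ℂ) * mFourier k (X i)) ?_ ?_ ?_ ?_ ?_
  · simpa using h
  · intro i _
    exact ((Continuous.stronglyMeasurable (by fun_prop)))
  · intro i _ X
    rw [norm_mul, norm_mFourier_apply, mul_one, Complex.norm_real]
    exact ha i
  · intro i _ j _ hij X y
    rw [shift_apply_of_ne hij]
  · intro j _ X
    simp_rw [shift_apply_self, mFourier_apply_add, ← mul_assoc]
    rw [integral_mul_const, integral_const_mul, integral_mFourier_of_ne_zero hk]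
    simp
  · intro j _ X
    simp_rw [shift_apply_self]
    exact Integrable.of_bound (Continuous.aestronglyMeasurable (by fun_prop)) |a j|
      (.of_forall fun x => by
        rw [norm_mul, norm_mFourier_apply, mul_one, Complex.norm_real, Real.norm_eq_abs])

lemma integral_comp_sub_positions {n : ℕ} {i j : Fin n} (hij : i ≠ j)
    {g : UnitAddTorus (Fin d) → ℝ} (hg : StronglyMeasurable g) {B : ℝ} (hB : ∀ x, ‖g x‖ ≤ B) :
    ∫ X, g (X i - X j) ∂positions d n = ∫ x, g x ∂uniformTorus d := by
  rw [← integral_integral_shift i (H := fun X : Fin n → UnitAddTorus (Fin d) => g (X i - X j))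
    (hg.comp_measurable (by fun_prop)) (fun X => hB _)]
  have : ∀ X : Fin n → UnitAddTorus (Fin d),
      ∫ y, g (shift i y X i - shift i y X j) ∂uniformTorus d = ∫ x, g x ∂uniformTorus d := by
    intro X
    simp_rw [shift_apply_self, shift_apply_of_ne hij.symm, add_sub_assoc]
    exact integral_add_right_eq_self g (X i - X j)
  simp [this]

/-- With `X i` held fixed, each summand depends on its own `X j` alone and is centered in it, so
cross terms vanish. -/
lemma integral_sq_sum_labelled_sub_density_le (FIn FOut : ConnectivityFunction d) {n : ℕ}
    (i : Fin n) (σ : Labelling n) {a : Fin n → ℝ} (ha : ∀ i, |a i| ≤ 1) :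
    ∫ X, (∑ j ∈ Finset.univ.erase i, a j * ((labelled FIn FOut (σ i) (σ j)).toFun (X i - X j)
      - (labelled FIn FOut (σ i) (σ j)).density)) ^ 2 ∂positions d n ≤ n := by
  have hbd : ∀ j x, ‖a j * ((labelled FIn FOut (σ i) (σ j)).toFun x
      - (labelled FIn FOut (σ i) (σ j)).density)‖ ≤ 1 := by
    intro j x
    rw [norm_mul]
    refine mul_le_one₀ (ha j) (norm_nonneg _) ?_
    set F := labelled FIn FOut (σ i) (σ j)
    rw [Real.norm_eq_abs, abs_le]
    constructor <;> linarith [F.nonneg x, F.le_one x, F.density_nonneg, F.density_le_one]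
  have hme : ∀ j, Measurable fun x => a j * ((labelled FIn FOut (σ i) (σ j)).toFun x
      - (labelled FIn FOut (σ i) (σ j)).density) := fun j =>
    ((labelled FIn FOut (σ i) (σ j)).measurable.sub_const _).const_mul _
  have h := integral_norm_sq_sum_le_of_shift (d := d) (F := ℝ) (Finset.univ.erase i)
    (f := fun j X => a j * ((labelled FIn FOut (σ i) (σ j)).toFun (X i - X j)
      - (labelled FIn FOut (σ i) (σ j)).density)) ?_ ?_ ?_ ?_ ?_
  · simp only [Real.norm_eq_abs, sq_abs] at h
    refine h.trans ?_
    exact_mod_cast (Finset.card_le_univ _).trans (by simp)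
  · intro j _
    exact ((hme j).comp (by fun_prop : Measurable fun X : Fin n → UnitAddTorus (Fin d) =>
      X i - X j)).stronglyMeasurable
  · exact fun j _ X => hbd j _
  · intro j hj l hl hjl X y
    rw [shift_apply_of_ne hjl, shift_apply_of_ne (Finset.ne_of_mem_erase hl).symm]
  · intro j hj X
    simp_rw [shift_apply_self, shift_apply_of_ne (Finset.ne_of_mem_erase hj).symm]
    -- Radial functions are even, so the reflected argument becomes a plain translation, under which
    -- the integral is invariant.
    set F := labelled FIn FOut (σ i) (σ j)
    have h1 : ∀ y, F.toFun (X i - (y + X j)) = F.toFun (y + (X j - X i)) := fun y => by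
      rw [← F.toFun_neg]
      congr 1
      abel
    simp_rw [h1]
    rw [integral_const_mul, integral_sub (F.integrable.comp_add_right _) (integrable_const _),
      integral_add_right_eq_self F.toFun]
    simp [ConnectivityFunction.density]
  · intro j _ X
    refine Integrable.of_bound ?_ 1 (.of_forall fun y => hbd j _)
    refine ((hme j).comp (g := fun x => _) ?_).aestronglyMeasurable
    simp_rw [shift_apply_self]
    by_cases h : i = j
    · subst h
      simp_rw [shift_apply_self]
      fun_prop
    · simp_rw [shift_apply_of_ne h]
      fun_prop

end Positions

/-! ### Moments of the centered adjacency matrix for given edge probabilities -/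

section RandomGraph

open Classical in
/-- The probability of the graph `G` if the pairs `i < j` are joined independently with
probability `p i j`. -/
def graphWeight {n : ℕ} (p : Fin n → Fin n → ℝ) (G : SimpleGraph (Fin n)) : ℝ :=
  ∏ i, ∏ j ∈ Finset.Ioi i, if G.Adj i j then p i j else 1 - p i j

/-- The graph `G` with the status of the pair `i, j` changed. -/
def toggle {n : ℕ} (i j : Fin n) (G : SimpleGraph (Fin n)) : SimpleGraph (Fin n) :=
  symmDiff G (SimpleGraph.edge i j)

open Classical in
/-- The adjacency matrix centered by the edge probabilities. -/
def centeredAdj {n : ℕ} (p : Fin n → Fin n → ℝ) (G : SimpleGraph (Fin n)) (i j : Fin n) : ℝ :=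
  if i = j then 0 else (if G.Adj i j then 1 else 0) - p i j

variable {n : ℕ} {p : Fin n → Fin n → ℝ}

lemma toggle_adj_self {i j : Fin n} (h : i ≠ j) (G : SimpleGraph (Fin n)) :
    (toggle i j G).Adj i j ↔ ¬ G.Adj i j := by
  simp [toggle, symmDiff, SimpleGraph.edge_adj, h]

lemma toggle_adj_of_ne {i j a b : Fin n} (h : ¬ (a = i ∧ b = j)) (h' : ¬ (a = j ∧ b = i))
    (G : SimpleGraph (Fin n)) : (toggle i j G).Adj a b ↔ G.Adj a b := by
  have : ¬ ((i = a ∧ j = b) ∨ (i = b ∧ j = a)) := by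
    rintro (⟨rfl, rfl⟩ | ⟨rfl, rfl⟩) <;> simp_all
  simp only [toggle, symmDiff, SimpleGraph.edge_adj, SimpleGraph.sup_adj, SimpleGraph.sdiff_adj]
  tauto

lemma toggle_toggle (i j : Fin n) (G : SimpleGraph (Fin n)) : toggle i j (toggle i j G) = G :=
  symmDiff_symmDiff_cancel_right _ _

lemma toggle_comm (i j : Fin n) : toggle i j = toggle j i := by
  funext G
  rw [toggle, toggle, SimpleGraph.edge_comm]

lemma centeredAdj_comm (hp : ∀ i j, p i j = p j i) (G : SimpleGraph (Fin n)) (i j : Fin n) :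
    centeredAdj p G i j = centeredAdj p G j i := by
  classical
  unfold centeredAdj
  rw [hp i j, if_congr (G.adj_comm i j) rfl rfl, if_congr (eq_comm (a := i)) rfl rfl]

lemma centeredAdj_self (G : SimpleGraph (Fin n)) (i : Fin n) : centeredAdj p G i i = 0 := by
  simp [centeredAdj]

lemma centeredAdj_toggle_of_ne {i j a b : Fin n} (h : ¬ (a = i ∧ b = j))
    (h' : ¬ (a = j ∧ b = i)) (G : SimpleGraph (Fin n)) :
    centeredAdj p (toggle i j G) a b = centeredAdj p G a b := by
  classical
  unfold centeredAdj
  rw [if_congr (toggle_adj_of_ne h h' G) rfl rfl]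

lemma abs_centeredAdj_le_one (h0 : ∀ i j, 0 ≤ p i j) (h1 : ∀ i j, p i j ≤ 1)
    (G : SimpleGraph (Fin n)) (i j : Fin n) : |centeredAdj p G i j| ≤ 1 := by
  have h0 := h0 i j
  have h1 := h1 i j
  unfold centeredAdj
  split_ifs <;> rw [abs_le] <;> constructor <;> linarith

lemma graphWeight_nonneg (h0 : ∀ i j, 0 ≤ p i j) (h1 : ∀ i j, p i j ≤ 1)
    (G : SimpleGraph (Fin n)) : 0 ≤ graphWeight p G := by
  refine Finset.prod_nonneg fun i _ => Finset.prod_nonneg fun j _ => ?_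
  split_ifs
  · exact h0 i j
  · linarith [h1 i j]

open Classical in
lemma graphWeight_eq_prod_sigma (G : SimpleGraph (Fin n)) :
    graphWeight p G = ∏ x ∈ (Finset.univ : Finset (Fin n)).sigma fun i => Finset.Ioi i,
      if G.Adj x.1 x.2 then p x.1 x.2 else 1 - p x.1 x.2 := by
  rw [graphWeight, Finset.prod_sigma']

open Classical in
lemma sum_graphWeight (p : Fin n → Fin n → ℝ) : ∑ G, graphWeight p G = 1 := by
  set P := (Finset.univ : Finset (Fin n)).sigma fun i => Finset.Ioi i with hP
  -- Expanding this product gives one term for each set of pairs `i < j`, and such sets correspond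
  -- to graphs.
  have h1 : ∏ x ∈ P, (p x.1 x.2 + (1 - p x.1 x.2)) = 1 := by simp
  rw [Finset.prod_add] at h1
  rw [← h1]
  have hadj : ∀ t ∈ P.powerset, ∀ x ∈ P,
      (SimpleGraph.fromRel fun i j => (⟨i, j⟩ : Σ _ : Fin n, Fin n) ∈ t).Adj x.1 x.2 ↔ x ∈ t := by
    intro t ht x hx
    have hx' : x.1 < x.2 := by simpa [hP] using hx
    rw [SimpleGraph.fromRel_adj]
    constructor
    · rintro ⟨-, h | h⟩
      · exact h
      · have h2 : (⟨x.2, x.1⟩ : Σ _ : Fin n, Fin n) ∈ P := Finset.mem_powerset.mp ht h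
        have h3 : x.2 < x.1 := by simpa [hP] using h2
        exact absurd hx' h3.asymm
    · exact fun h => ⟨hx'.ne, .inl h⟩
  refine Finset.sum_bij' (fun G _ => P.filter fun x => G.Adj x.1 x.2)
    (fun t _ => SimpleGraph.fromRel fun i j => (⟨i, j⟩ : Σ _ : Fin n, Fin n) ∈ t) ?_ ?_ ?_ ?_ ?_
  · intro G _
    simp
  · intro t _
    simp
  · intro G _
    ext i j
    rw [SimpleGraph.fromRel_adj]
    simp only [hP, Finset.mem_filter, Finset.mem_sigma, Finset.mem_univ, Finset.mem_Ioi, true_and]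
    constructor
    · rintro ⟨-, h | h⟩
      · exact h.2
      · exact h.2.symm
    · intro h
      rcases lt_or_gt_of_ne h.ne with h' | h'
      · exact ⟨h.ne, .inl ⟨h', h⟩⟩
      · exact ⟨h.ne, .inr ⟨h', h.symm⟩⟩
  · intro t ht
    ext x
    refine (@Finset.mem_filter _ _ (fun _ => Classical.propDecidable _) P x).trans ?_
    constructor
    · rintro ⟨hx, h⟩
      exact (hadj t ht x hx).mp h
    · exact fun h => ⟨Finset.mem_powerset.mp ht h,
        (hadj t ht x (Finset.mem_powerset.mp ht h)).mpr h⟩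
  · intro G _
    rw [graphWeight_eq_prod_sigma, Finset.prod_ite]
    congr 2
    rw [Finset.filter_not]

/-- At the toggled pair the weight times the centered entry is `p (1 - p)` with the edge and `-(1 -
p) p` without it; all other factors agree. -/
lemma graphWeight_toggle_mul (hp : ∀ i j, p i j = p j i) {i j : Fin n} (hij : i ≠ j)
    (G : SimpleGraph (Fin n)) :
    graphWeight p (toggle i j G) * centeredAdj p (toggle i j G) i j =
      -(graphWeight p G * centeredAdj p G i j) := by
  classical
  wlog h : i < j generalizing i j
  · rw [toggle_comm, centeredAdj_comm hp, centeredAdj_comm hp G]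
    exact this hij.symm (lt_of_le_of_ne (not_lt.mp h) hij.symm)
  have hmem : (⟨i, j⟩ : Σ _ : Fin n, Fin n) ∈
      (Finset.univ : Finset (Fin n)).sigma fun i => Finset.Ioi i := by simpa using h
  rw [graphWeight_eq_prod_sigma, graphWeight_eq_prod_sigma, ← Finset.mul_prod_erase _ _ hmem,
    ← Finset.mul_prod_erase _ _ hmem]
  have : ∀ x ∈ ((Finset.univ : Finset (Fin n)).sigma fun i => Finset.Ioi i).erase ⟨i, j⟩,
      ((toggle i j G).Adj x.1 x.2 ↔ G.Adj x.1 x.2) := by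
    intro x hx
    obtain ⟨hx1, hx2⟩ := Finset.mem_erase.mp hx
    have hx2 : x.1 < x.2 := by simpa using hx2
    refine toggle_adj_of_ne ?_ ?_ G
    · rintro ⟨h1, h2⟩
      exact hx1 (Sigma.ext h1 (heq_of_eq h2))
    · rintro ⟨h1, h2⟩
      rw [h1, h2] at hx2
      exact absurd h hx2.asymm
  rw [Finset.prod_congr rfl fun x hx => by rw [if_congr (this x hx) rfl rfl]]
  simp only [centeredAdj, hij, if_false, toggle_adj_self hij]
  by_cases hG : G.Adj i j <;> simp [hG] <;> ring

/-- Toggling the pair is a sign-reversing involution on the terms. It plays the role of independence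
and centering of the edges. -/
lemma sum_graphWeight_mul_centeredAdj_mul (hp : ∀ i j, p i j = p j i) {i j : Fin n}
    (hij : i ≠ j) {f : SimpleGraph (Fin n) → ℝ} (hf : ∀ G, f (toggle i j G) = f G) :
    ∑ G, graphWeight p G * (centeredAdj p G i j * f G) = 0 := by
  have h : ∑ G, graphWeight p G * (centeredAdj p G i j * f G) =
      ∑ G, -(graphWeight p G * (centeredAdj p G i j * f G)) := by
    refine Finset.sum_bij' (fun G _ => toggle i j G) (fun G _ => toggle i j G) (by simp) (by simp)
      (fun G _ => toggle_toggle i j G) (fun G _ => toggle_toggle i j G) fun G _ => ?_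
    rw [← mul_assoc, ← mul_assoc, graphWeight_toggle_mul hp hij, hf]
    ring
  rw [Finset.sum_neg_distrib] at h
  linarith

lemma sum_mul_sq_sum_le {α ι : Type*} [Fintype α] {w : α → ℝ} (hw : ∀ x, 0 ≤ w x)
    (hw1 : ∑ x, w x = 1) (s : Finset ι) {f : ι → α → ℝ} (hb : ∀ i ∈ s, ∀ x, |f i x| ≤ 1)
    (ho : ∀ i ∈ s, ∀ j ∈ s, i ≠ j → ∑ x, w x * (f i x * f j x) = 0) :
    ∑ x, w x * (∑ i ∈ s, f i x) ^ 2 ≤ s.card := by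
  have h : ∑ x, w x * (∑ i ∈ s, f i x) ^ 2 =
      ∑ i ∈ s, ∑ j ∈ s, ∑ x, w x * (f i x * f j x) := by
    simp_rw [sq, Finset.sum_mul_sum, Finset.mul_sum]
    rw [Finset.sum_comm]
    exact Finset.sum_congr rfl fun i _ => Finset.sum_comm
  rw [h]
  have : ∀ i ∈ s, ∑ j ∈ s, ∑ x, w x * (f i x * f j x) ≤ 1 := by
    intro i hi
    rw [Finset.sum_eq_single_of_mem i hi fun j hj hji => ho i hi j hj hji.symm, ← hw1]
    refine Finset.sum_le_sum fun x _ => mul_le_of_le_one_right (hw x) ?_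
    rw [← sq, ← sq_abs]
    exact pow_le_one₀ (abs_nonneg _) (hb i hi x)
  simpa using Finset.sum_le_sum this

lemma sum_graphWeight_mul_sum_sq_mulVec_le (hp : ∀ i j, p i j = p j i) (h0 : ∀ i j, 0 ≤ p i j)
    (h1 : ∀ i j, p i j ≤ 1) {a : Fin n → ℝ} (ha : ∀ i, |a i| ≤ 1) :
    ∑ G, graphWeight p G * ∑ i, (∑ j, centeredAdj p G i j * a j) ^ 2 ≤ (n : ℝ) ^ 2 := by
  simp_rw [Finset.mul_sum]
  rw [Finset.sum_comm]
  have : ∀ i ∈ (Finset.univ : Finset (Fin n)),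
      ∑ G, graphWeight p G * (∑ j, centeredAdj p G i j * a j) ^ 2 ≤ n := by
    intro i _
    refine (sum_mul_sq_sum_le (graphWeight_nonneg h0 h1) (sum_graphWeight p) Finset.univ
      (f := fun j G => centeredAdj p G i j * a j) ?_ ?_).trans (by simp)
    · intro j _ G
      rw [abs_mul]
      exact mul_le_one₀ (abs_centeredAdj_le_one h0 h1 G i j) (abs_nonneg _) (ha j)
    · intro j _ l _ hjl
      by_cases hij : i = j
      · simp [hij, centeredAdj_self]
      refine Eq.trans (Finset.sum_congr rfl fun G _ => ?_)
        (sum_graphWeight_mul_centeredAdj_mul hp hij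
          (f := fun G => a j * (centeredAdj p G i l * a l)) fun G => ?_)
      · ring
      · rw [centeredAdj_toggle_of_ne (fun h => hjl h.2.symm) (fun h => hij h.1)]
  calc _ ≤ ∑ i : Fin n, (n : ℝ) := Finset.sum_le_sum this
    _ = _ := by simp [sq]

/-- This is the mean squared Frobenius norm of `M²`. Off the diagonal the products along different
`k` are uncorrelated, because the edge `i k` occurs only once in a cross term; each such entry
contributes at most `n`. The `n` diagonal entries are bounded trivially by `n²` each. -/
lemma sum_graphWeight_mul_sum_sq_mul_self_le (hp : ∀ i j, p i j = p j i)
    (h0 : ∀ i j, 0 ≤ p i j) (h1 : ∀ i j, p i j ≤ 1) :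
    ∑ G, graphWeight p G *
      ∑ i, ∑ j, (∑ k, centeredAdj p G i k * centeredAdj p G k j) ^ 2 ≤ 2 * (n : ℝ) ^ 3 := by
  have hle : ∀ G i j k, |centeredAdj p G i k * centeredAdj p G k j| ≤ 1 := by
    intro G i j k
    rw [abs_mul]
    exact mul_le_one₀ (abs_centeredAdj_le_one h0 h1 G i k) (abs_nonneg _)
      (abs_centeredAdj_le_one h0 h1 G k j)
  have hij : ∀ i j : Fin n,
      ∑ G, graphWeight p G * (∑ k, centeredAdj p G i k * centeredAdj p G k j) ^ 2 ≤
        n + if i = j then (n : ℝ) ^ 2 else 0 := by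
    intro i j
    by_cases h : i = j
    · rw [if_pos h]
      calc _ ≤ ∑ G, graphWeight p G * (n : ℝ) ^ 2 := by
            refine Finset.sum_le_sum fun G _ =>
              mul_le_mul_of_nonneg_left ?_ (graphWeight_nonneg h0 h1 G)
            rw [← sq_abs]
            refine pow_le_pow_left₀ (abs_nonneg _) ?_ 2
            refine (Finset.abs_sum_le_sum_abs _ _).trans ?_
            refine (Finset.sum_le_sum fun k _ => hle G i j k).trans (by simp)
        _ = (n : ℝ) ^ 2 := by rw [← Finset.sum_mul, sum_graphWeight, one_mul]
        _ ≤ _ := by simp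
    · rw [if_neg h, add_zero]
      refine (sum_mul_sq_sum_le (graphWeight_nonneg h0 h1) (sum_graphWeight p) Finset.univ
        (f := fun k G => centeredAdj p G i k * centeredAdj p G k j) ?_ ?_).trans (by simp)
      · exact fun k _ G => hle G i j k
      · intro k _ l _ hkl
        by_cases hik : i = k
        · simp [hik, centeredAdj_self]
        by_cases hil : i = l
        · simp [hil, centeredAdj_self]
        refine Eq.trans (Finset.sum_congr rfl fun G _ => ?_)
          (sum_graphWeight_mul_centeredAdj_mul hp hik
            (f := fun G => centeredAdj p G k j * (centeredAdj p G i l * centeredAdj p G l j))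
            fun G => ?_)
        · ring
        · rw [centeredAdj_toggle_of_ne (a := k) (by grind) (by grind),
            centeredAdj_toggle_of_ne (a := i) (by grind) (by grind),
            centeredAdj_toggle_of_ne (a := l) (by grind) (by grind)]
  calc _ = ∑ i, ∑ j, ∑ G,
        graphWeight p G * (∑ k, centeredAdj p G i k * centeredAdj p G k j) ^ 2 := by
        simp_rw [Finset.mul_sum]
        rw [Finset.sum_comm]
        exact Finset.sum_congr rfl fun i _ => Finset.sum_comm
    _ ≤ ∑ i : Fin n, ∑ j : Fin n, (n + if i = j then (n : ℝ) ^ 2 else 0) :=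
        Finset.sum_le_sum fun i _ => Finset.sum_le_sum fun j _ => hij i j
    _ = _ := by
        simp [Finset.sum_add_distrib]
        ring

end RandomGraph

/-! ### Operator norms and lower bounds for shifted matrices -/

section LinearAlgebra

open scoped Matrix Matrix.Norms.L2Operator
open WithLp (toLp)

lemma norm_mulVec_le {m ι : Type*} [Fintype m] [Fintype ι] [DecidableEq ι]
    (A : Matrix m ι ℂ) (x : ι → ℂ) : ‖toLp 2 (A *ᵥ x)‖ ≤ ‖A‖ * ‖toLp 2 x‖ :=
  A.l2_opNorm_mulVec (toLp 2 x)

lemma norm_toLp_sq {ι 𝕜 : Type*} [RCLike 𝕜] [Fintype ι] (x : ι → 𝕜) :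
    ‖toLp 2 x‖ ^ 2 = ∑ i, ‖x i‖ ^ 2 :=
  EuclideanSpace.norm_sq_eq _

lemma norm_matrix_sq_le_sum {m ι : Type*} [Fintype m] [Fintype ι] [DecidableEq ι]
    (A : Matrix m ι ℂ) : ‖A‖ ^ 2 ≤ ∑ i, ∑ j, ‖A i j‖ ^ 2 := by
  have h0 : 0 ≤ ∑ i, ∑ j, ‖A i j‖ ^ 2 :=
    Finset.sum_nonneg fun i _ => Finset.sum_nonneg fun j _ => sq_nonneg _
  have h : ‖A‖ ≤ √(∑ i, ∑ j, ‖A i j‖ ^ 2) := by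
    rw [Matrix.l2_opNorm_def]
    refine ContinuousLinearMap.opNorm_le_bound _ (Real.sqrt_nonneg _) fun x => ?_
    refine (sq_le_sq₀ (norm_nonneg _) (by positivity)).mp ?_
    rw [mul_pow, Real.sq_sqrt h0, EuclideanSpace.norm_sq_eq, EuclideanSpace.norm_sq_eq x,
      Finset.sum_mul]
    refine Finset.sum_le_sum fun i _ => ?_
    calc ‖∑ j, A i j * x j‖ ^ 2 ≤ (∑ j, ‖A i j‖ * ‖x j‖) ^ 2 := by
          refine pow_le_pow_left₀ (norm_nonneg _) ((norm_sum_le _ _).trans_eq ?_) 2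
          simp_rw [norm_mul]
      _ ≤ _ := Finset.sum_mul_sq_le_sq_mul_sq _ _ _
  calc ‖A‖ ^ 2 ≤ √(∑ i, ∑ j, ‖A i j‖ ^ 2) ^ 2 := pow_le_pow_left₀ (norm_nonneg _) h 2
    _ = _ := Real.sq_sqrt h0

/-- A matrix `U D Uᴴ` with almost orthonormal columns of `U` is bounded away from `lam` on the
vectors whose components along the columns vanish wherever `D` is close to `lam`. -/
lemma mul_norm_le_norm_mulVec_sub {m ι : Type*} [Fintype m] [Fintype ι] [DecidableEq ι]
    [DecidableEq m] (U : Matrix m ι ℂ) (D : ι → ℂ) {lam : ℂ} {γ : ℝ} (hγ : 0 < γ)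
    (hD : ∀ i, ‖D i‖ ≤ 1)
    (hU1 : ‖Uᴴ * U - 1‖ ≤ 1) (hUγ : ‖Uᴴ * U - 1‖ ≤ γ / 2) (w : m → ℂ)
    (hw : ∀ i, γ ≤ ‖D i - lam‖ ∨ (Uᴴ *ᵥ w) i = 0) :
    ‖lam‖ / (8 / γ + 1) * ‖toLp 2 w‖ ≤
      ‖toLp 2 ((U * Matrix.diagonal D * Uᴴ) *ᵥ w - lam • w)‖ := by
  set z := Uᴴ *ᵥ w with hz
  set x := Matrix.diagonal D *ᵥ z with hx
  set y := (U * Matrix.diagonal D * Uᴴ) *ᵥ w - lam • w with hy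
  have hyx : y = U *ᵥ x - lam • w := by
    rw [hy, hx, hz, Matrix.mulVec_mulVec, Matrix.mulVec_mulVec, Matrix.mul_assoc]
  have hone : ‖(1 : Matrix ι ι ℂ)‖ ≤ 1 := by
    rw [← Matrix.diagonal_one, Matrix.l2_opNorm_diagonal]
    exact (pi_norm_le_iff_of_nonneg zero_le_one).mpr fun i => by simp
  -- The C⋆-identity gives `‖U‖² ≤ 2`; the cruder bound suffices.
  have hU : ‖U‖ ≤ 2 := by
    have h1 : ‖U‖ * ‖U‖ ≤ 2 := by
      rw [← Matrix.l2_opNorm_conjTranspose_mul_self]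
      calc ‖Uᴴ * U‖ = ‖(Uᴴ * U - 1) + 1‖ := by rw [sub_add_cancel]
        _ ≤ 1 + 1 := (norm_add_le _ _).trans (add_le_add hU1 hone)
        _ = 2 := by norm_num
    nlinarith [norm_nonneg U]
  have hU' : ‖Uᴴ‖ ≤ 2 := by rwa [Matrix.l2_opNorm_conjTranspose]
  have hxz : ‖toLp 2 x‖ ≤ ‖toLp 2 z‖ := by
    refine (norm_mulVec_le _ _).trans (mul_le_of_le_one_left (norm_nonneg _) ?_)
    rw [Matrix.l2_opNorm_diagonal]
    exact (pi_norm_le_iff_of_nonneg zero_le_one).mpr hD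
  have hgap : γ * ‖toLp 2 z‖ ≤ ‖toLp 2 (x - lam • z)‖ := by
    refine (sq_le_sq₀ (by positivity) (norm_nonneg _)).mp ?_
    rw [mul_pow, norm_toLp_sq, norm_toLp_sq, Finset.mul_sum]
    refine Finset.sum_le_sum fun i _ => ?_
    have : (x - lam • z) i = (D i - lam) * z i := by
      simp [hx, Matrix.mulVec_diagonal, sub_mul]
    rw [this, norm_mul, mul_pow]
    rcases hw i with h | h
    · gcongr
    · simp [h]
  -- In the coordinates `z = Uᴴ w`, the residual is `(D - lam) z` up to the Gram defect. The defect
  -- costs at most `γ / 2 * ‖z‖`, half of what the gap provides.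
  have hUy : Uᴴ *ᵥ y = (x - lam • z) + (Uᴴ * U - 1) *ᵥ x := by
    rw [hyx, Matrix.mulVec_sub, Matrix.mulVec_smul, Matrix.mulVec_mulVec, Matrix.sub_mulVec,
      Matrix.one_mulVec, ← hz]
    abel
  have h1 : γ * ‖toLp 2 z‖ ≤ 2 * ‖toLp 2 y‖ + γ / 2 * ‖toLp 2 z‖ := by
    have e : toLp 2 (x - lam • z) = toLp 2 (Uᴴ *ᵥ y) - toLp 2 ((Uᴴ * U - 1) *ᵥ x) := by
      rw [hUy, WithLp.toLp_add, add_sub_cancel_right]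
    calc γ * ‖toLp 2 z‖ ≤ ‖toLp 2 (Uᴴ *ᵥ y)‖ + ‖toLp 2 ((Uᴴ * U - 1) *ᵥ x)‖ := by
          rw [e] at hgap
          exact hgap.trans (norm_sub_le _ _)
      _ ≤ 2 * ‖toLp 2 y‖ + γ / 2 * ‖toLp 2 z‖ := by
          refine add_le_add ((norm_mulVec_le _ _).trans (by gcongr))
            ((norm_mulVec_le _ _).trans ?_)
          gcongr
  have hzy : ‖toLp 2 z‖ ≤ 4 / γ * ‖toLp 2 y‖ := by
    rw [div_mul_eq_mul_div, le_div_iff₀ hγ]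
    linarith
  -- The part of `w` outside the range of `U` is recovered from `lam w = U x - y`: a small `z` makes
  -- `U x` small, and `lam` is the only term left.
  have hlam : ‖lam‖ * ‖toLp 2 w‖ ≤ (8 / γ + 1) * ‖toLp 2 y‖ := by
    have e : lam • toLp 2 w = toLp 2 (U *ᵥ x) - toLp 2 y := by
      rw [hyx, ← WithLp.toLp_sub, sub_sub_cancel, WithLp.toLp_smul]
    rw [← norm_smul, e]
    calc _ ≤ ‖toLp 2 (U *ᵥ x)‖ + ‖toLp 2 y‖ := norm_sub_le _ _
      _ ≤ 2 * (4 / γ * ‖toLp 2 y‖) + ‖toLp 2 y‖ := by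
          refine add_le_add_left ((norm_mulVec_le _ _).trans ?_) _
          refine mul_le_mul hU (hxz.trans hzy) (norm_nonneg _) (by norm_num)
      _ = _ := by ring
  rw [div_mul_eq_mul_div, div_le_iff₀ (by positivity)]
  linarith

/-- The distance from `t` to the spectrum bounds `A - t` from below. -/
lemma abs_mul_norm_le_of_forall_eigenvalue {n : ℕ} {A : Matrix (Fin n) (Fin n) ℝ}
    (hA : A.IsHermitian) {t δ : ℝ}
    (h : ∀ lam, Module.End.HasEigenvalue (Matrix.toLin' A) lam → |δ| ≤ |lam - t|)
    (u : Fin n → ℝ) : δ ^ 2 * ∑ i, u i ^ 2 ≤ ∑ i, ((A *ᵥ u) i - t * u i) ^ 2 := by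
  have hb : ∀ i, |δ| ≤ |hA.eigenvalues i - t| := by
    intro i
    refine h _ (Module.End.hasEigenvalue_of_hasEigenvector
      (x := (hA.eigenvectorBasis i : Fin n → ℝ)) ⟨?_, ?_⟩)
    · rw [Module.End.mem_eigenspace_iff, Matrix.toLin'_apply, hA.mulVec_eigenvectorBasis]
    · intro h0
      have := hA.eigenvectorBasis.orthonormal.ne_zero i
      exact this (by ext j; exact congrFun h0 j)
  have hsq : ∀ x : Fin n → ℝ, ∑ i, x i ^ 2 = ‖toLp 2 x‖ ^ 2 := fun x => by
    rw [norm_toLp_sq]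
    simp
  have e : ∑ i, ((A *ᵥ u) i - t * u i) ^ 2 = ‖toLp 2 (A *ᵥ u - t • u)‖ ^ 2 := by
    rw [← hsq]
    rfl
  -- Parseval in an eigenbasis, where `A - t` acts on each coordinate by `eigenvalue - t`.
  rw [e, hsq, ← hA.eigenvectorBasis.sum_sq_norm_inner_right,
    ← hA.eigenvectorBasis.sum_sq_norm_inner_right, Finset.mul_sum]
  refine Finset.sum_le_sum fun i _ => ?_
  have hin : inner ℝ (hA.eigenvectorBasis i) (toLp 2 (A *ᵥ u - t • u)) =
      (hA.eigenvalues i - t) * inner ℝ (hA.eigenvectorBasis i) (toLp 2 u) := by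
    simp only [EuclideanSpace.inner_eq_star_dotProduct, star_trivial]
    rw [sub_dotProduct, smul_dotProduct, dotProduct_comm, Matrix.dotProduct_mulVec,
      ← Matrix.mulVec_transpose]
    have : Aᵀ = A := (Matrix.conjTranspose_eq_transpose_of_trivial A).symm.trans hA
    rw [this, hA.mulVec_eigenvectorBasis, smul_dotProduct, dotProduct_comm]
    simp only [smul_eq_mul]
    ring
  rw [hin, norm_mul, mul_pow, ← sq_abs δ]
  refine mul_le_mul_of_nonneg_right ?_ (sq_nonneg _)
  exact pow_le_pow_left₀ (abs_nonneg _) (hb i) 2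

end LinearAlgebra

/-! ### From an approximate eigenvector and a gap to few misclassified nodes -/

section Stability

open scoped Matrix

/-- The label of a node as a sign. -/
def sign {n : ℕ} (σ : Labelling n) (i : Fin n) : ℝ := if σ i = 0 then 1 else -1

lemma abs_sign {n : ℕ} (σ : Labelling n) (i : Fin n) : |sign σ i| = 1 := by
  unfold sign
  split_ifs <;> simp

lemma sign_sq {n : ℕ} (σ : Labelling n) (i : Fin n) : sign σ i ^ 2 = 1 := by
  rw [← sq_abs, abs_sign, one_pow]

lemma misclassified_le {n : ℕ} (σ τ : Labelling n) (π : Equiv.Perm (Fin 2)) :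
    misclassified σ τ ≤ (Finset.univ.filter fun i => σ i ≠ π (τ i)).card :=
  ciInf_le (OrderBot.bddBelow _) π

/-- Rounding a vector close to a nonzero multiple of the signs of `σ`. -/
lemma misclassified_mul_sq_le {n : ℕ} (σ τ : Labelling n) (v : Fin n → ℝ) {a : ℝ} (ha : a ≠ 0)
    (hτ : ∀ i, τ i = if 0 < v i then 0 else 1) :
    misclassified σ τ * a ^ 2 ≤ ∑ i, (v i - a * sign σ i) ^ 2 := by
  have hcount : ∀ s : Finset (Fin n), (∀ i ∈ s, a ^ 2 ≤ (v i - a * sign σ i) ^ 2) →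
      s.card * a ^ 2 ≤ ∑ i, (v i - a * sign σ i) ^ 2 := by
    intro s hs
    calc s.card * a ^ 2 = ∑ i ∈ s, a ^ 2 := by simp
      _ ≤ ∑ i ∈ s, (v i - a * sign σ i) ^ 2 := Finset.sum_le_sum hs
      _ ≤ _ := Finset.sum_le_univ_sum_of_nonneg fun i => sq_nonneg _
  have h2 : ∀ x : Fin 2, x = 0 ∨ x = 1 := by decide
  -- For negative `a` the rounding returns the swapped labels. In both cases, at a wrong node `v i`
  -- is not on the side of zero where `a * sign σ i` lies, so the two differ by at least `|a|`.
  rcases lt_or_gt_of_ne ha with h | h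
  · refine le_trans ?_ (hcount (Finset.univ.filter fun i => σ i ≠ Equiv.swap 0 1 (τ i)) ?_)
    · gcongr
      exact misclassified_le σ τ _
    · intro i hi
      have hi := (Finset.mem_filter.mp hi).2
      rw [hτ i] at hi
      rcases h2 (σ i) with h0 | h0 <;> by_cases hv : 0 < v i <;> simp [h0, hv] at hi <;>
        simp [sign, h0] <;> nlinarith
  · refine le_trans ?_ (hcount (Finset.univ.filter fun i => σ i ≠ Equiv.refl _ (τ i)) ?_)
    · gcongr
      exact misclassified_le σ τ _
    · intro i hi
      have hi := (Finset.mem_filter.mp hi).2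
      rw [hτ i] at hi
      rcases h2 (σ i) with h0 | h0 <;> by_cases hv : 0 < v i <;> simp [h0, hv] at hi <;>
        simp [sign, h0] <;> nlinarith

open Classical in
/-- If the signs of `σ` are an approximate eigenvector with residual `R`, and the adjacency matrix
is bounded away from the target on their orthogonal complement, then the spectral clustering makes
few errors. -/
lemma misclassified_le_of_gap {n : ℕ} {μin μout : ℝ} {G : SimpleGraph (Fin n)}
    {σ τ : Labelling n} (hn : 0 < n) (hτ : IsHOSCOutput μin μout G τ) {κ R : ℝ} (hκ : 0 < κ)
    (hR : ∑ i, ((G.adjMatrix ℝ *ᵥ sign σ) i - (μin - μout) / 2 * n * sign σ i) ^ 2 ≤ R)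
    (hRκ : 8 * R ≤ n * κ ^ 2)
    (hgap : ∀ w : Fin n → ℝ, ∑ i, sign σ i * w i = 0 → κ ^ 2 * ∑ i, w i ^ 2 ≤
      ∑ i, ((G.adjMatrix ℝ *ᵥ w) i - (μin - μout) / 2 * n * w i) ^ 2) :
    (misclassified σ τ : ℝ) ≤ 8 * R / κ ^ 2 := by
  obtain ⟨lam, v, hv, hmin, hout⟩ := hτ
  set t := (μin - μout) / 2 * n with ht
  set A := G.adjMatrix ℝ with hA
  have hn' : (0 : ℝ) < n := by exact_mod_cast hn
  have hherm : A.IsHermitian := by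
    rw [Matrix.IsHermitian, Matrix.conjTranspose_eq_transpose_of_trivial, hA,
      SimpleGraph.transpose_adjMatrix]
  have hs2 : ∑ i, sign σ i ^ 2 = n := by simp [sign_sq]
  -- `lam` is the eigenvalue closest to `t`, so `A - t` is bounded below by `|lam - t|`; testing on
  -- the sign vector, of squared norm `n`, gives the bound.
  have hδ : (lam - t) ^ 2 * n ≤ R := by
    have := abs_mul_norm_le_of_forall_eigenvalue hherm (t := t) (δ := lam - t) hmin (sign σ)
    rw [hs2] at this
    exact this.trans hR
  have hAv : ∀ i, (A *ᵥ v) i = lam * v i := fun i => by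
    have := (Module.End.mem_eigenspace_iff.mp hv.1)
    rw [Matrix.toLin'_apply] at this
    exact congrFun this i
  -- Orthogonal decomposition `v = a s + w` along the sign vector `s`.
  set a := (∑ i, sign σ i * v i) / n with ha
  set w : Fin n → ℝ := fun i => v i - a * sign σ i with hw
  have hsw : ∑ i, sign σ i * w i = 0 := by
    have : ∀ i, sign σ i * w i = sign σ i * v i - a * sign σ i ^ 2 := fun i => by
      simp only [hw]
      ring
    simp_rw [this]
    rw [Finset.sum_sub_distrib, ← Finset.mul_sum, hs2, ha, div_mul_cancel₀ _ hn'.ne', sub_self]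
  have hpyth : ∑ i, v i ^ 2 = a ^ 2 * n + ∑ i, w i ^ 2 := by
    have : ∀ i, v i ^ 2 = a ^ 2 * sign σ i ^ 2 + w i ^ 2 + 2 * a * (sign σ i * w i) := fun i => by
      simp only [hw]
      ring
    simp_rw [this]
    rw [Finset.sum_add_distrib, Finset.sum_add_distrib, ← Finset.mul_sum, ← Finset.mul_sum, hsw,
      hs2]
    ring
  have hres : ∑ i, ((A *ᵥ w) i - t * w i) ^ 2 ≤ 2 * ((lam - t) ^ 2 * ∑ i, v i ^ 2) +
      2 * (a ^ 2 * R) := by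
    have hAw : A *ᵥ w = A *ᵥ v - a • A *ᵥ sign σ := by
      rw [← Matrix.mulVec_smul, ← Matrix.mulVec_sub]
      rfl
    calc ∑ i, ((A *ᵥ w) i - t * w i) ^ 2
        ≤ ∑ i, (2 * ((lam - t) ^ 2 * v i ^ 2) +
          2 * (a ^ 2 * ((A *ᵥ sign σ) i - t * sign σ i) ^ 2)) := by
          refine Finset.sum_le_sum fun i _ => ?_
          have : (A *ᵥ w) i - t * w i =
              (lam - t) * v i - a * ((A *ᵥ sign σ) i - t * sign σ i) := by
            rw [hAw, Pi.sub_apply, Pi.smul_apply, hAv, smul_eq_mul]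
            simp only [hw]
            ring
          rw [this]
          nlinarith [sq_nonneg ((lam - t) * v i + a * ((A *ᵥ sign σ) i - t * sign σ i))]
      _ ≤ _ := by
          rw [Finset.sum_add_distrib, ← Finset.mul_sum, ← Finset.mul_sum, ← Finset.mul_sum,
            ← Finset.mul_sum]
          gcongr
  have hW : κ ^ 2 * ∑ i, w i ^ 2 ≤ 2 * ((lam - t) ^ 2 * ∑ i, v i ^ 2) + 2 * (a ^ 2 * R) :=
    (hgap w hsw).trans hres
  set V := ∑ i, v i ^ 2
  set W := ∑ i, w i ^ 2 with hWdef
  have hV : 0 < V := by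
    obtain ⟨i, hi⟩ := Function.ne_iff.mp hv.2
    exact Finset.sum_pos' (fun j _ => sq_nonneg _) ⟨i, Finset.mem_univ i, by
      have : v i ≠ 0 := hi
      positivity⟩
  have hW0 : 0 ≤ W := Finset.sum_nonneg fun i _ => sq_nonneg _
  have hR0 : 0 ≤ R := (Finset.sum_nonneg fun i _ => sq_nonneg _).trans hR
  have haV : a ^ 2 * n ≤ V := by linarith
  have hκ2 : 0 < κ ^ 2 := by positivity
  have h4 : κ ^ 2 * n * W ≤ 4 * R * V := by
    have h1 : (lam - t) ^ 2 * n * V ≤ R * V := mul_le_mul_of_nonneg_right hδ hV.le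
    have h2 : a ^ 2 * n * R ≤ V * R := mul_le_mul_of_nonneg_right haV hR0
    have h3 := mul_le_mul_of_nonneg_right hW hn'.le
    nlinarith
  -- The condition `8 R ≤ n κ²` leaves at least half of the squared norm of `v` along the signs; in
  -- particular `a ≠ 0`.
  have hWV : W ≤ V / 2 := by
    have : κ ^ 2 * n * W ≤ κ ^ 2 * n * (V / 2) := by nlinarith
    exact le_of_mul_le_mul_left this (by positivity)
  have haV' : V ≤ 2 * (a ^ 2 * n) := by linarith
  have ha0 : a ≠ 0 := by
    intro h
    rw [h] at haV'
    simp at haV'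
    linarith
  have hfin : κ ^ 2 * W ≤ 8 * R * a ^ 2 := by
    have : n * (κ ^ 2 * W) ≤ n * (8 * R * a ^ 2) := by nlinarith
    exact le_of_mul_le_mul_left this hn'
  have hmis := misclassified_mul_sq_le σ τ v ha0 hout
  rw [le_div_iff₀ hκ2]
  have ha2 : 0 < a ^ 2 := by positivity
  have : misclassified σ τ * κ ^ 2 * a ^ 2 ≤ 8 * R * a ^ 2 := by nlinarith
  exact le_of_mul_le_mul_right this ha2

end Stability

/-! ### Comparison of the adjacency matrix with a finite-rank Fourier model -/

section Comparison

open scoped Matrix Matrix.Norms.L2Operator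
open WithLp (toLp)

variable {d : ℕ} (FIn FOut : ConnectivityFunction d) {n : ℕ}

/-- The edge probabilities given the labels and the positions. -/
def edgeProbs (σ : Labelling n) (X : Fin n → UnitAddTorus (Fin d)) (i j : Fin n) : ℝ :=
  edgeProb FIn FOut (X i - X j) (σ i) (σ j)

/-- The Fourier modes with frequencies in `S`, plain and multiplied by the signs of the labels,
at the positions of the nodes. -/
def modes (S : Finset (Fin d → ℤ)) (σ : Labelling n) (X : Fin n → UnitAddTorus (Fin d)) :
    Matrix (Fin n) (S × Fin 2) ℂ :=
  Matrix.of fun i x => (√n : ℂ)⁻¹ * (((if x.2 = 0 then 1 else sign σ i : ℝ) : ℂ) *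
    mFourier (x.1 : Fin d → ℤ) (X i))

/-- The limiting eigenvalues of the rescaled adjacency matrix. -/
def modeEigenvalue (k : Fin d → ℤ) (b : Fin 2) : ℂ :=
  if b = 0 then (FIn.fourierCoeff k + FOut.fourierCoeff k) / 2
  else (FIn.fourierCoeff k - FOut.fourierCoeff k) / 2

lemma norm_modeEigenvalue_le_one (k : Fin d → ℤ) (b : Fin 2) :
    ‖modeEigenvalue FIn FOut k b‖ ≤ 1 := by
  have h1 := FIn.norm_fourierCoeff_le_one k
  have h2 := FOut.norm_fourierCoeff_le_one k
  unfold modeEigenvalue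
  split_ifs
  · rw [norm_div, Complex.norm_two, div_le_one two_pos]
    linarith [norm_add_le (FIn.fourierCoeff k) (FOut.fourierCoeff k)]
  · rw [norm_div, Complex.norm_two, div_le_one two_pos]
    linarith [norm_sub_le (FIn.fourierCoeff k) (FOut.fourierCoeff k)]

/-- The limiting eigenvalues tend to `0` while the target is nonzero, so only finitely many come
within half its modulus. Among these the hypotheses rule out equality, except for frequency `0` with
signs, whose eigenvalue is the target itself. -/
lemma exists_gap (hne : FIn.density ≠ FOut.density)
    (hsum : ∀ k : Fin d → ℤ,
      FIn.fourierCoeff k + FOut.fourierCoeff k ≠ ((FIn.density - FOut.density : ℝ) : ℂ))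
    (hdiff : ∀ k : Fin d → ℤ, k ≠ 0 →
      FIn.fourierCoeff k - FOut.fourierCoeff k ≠ ((FIn.density - FOut.density : ℝ) : ℂ)) :
    ∃ γ : ℝ, 0 < γ ∧ ∀ (k : Fin d → ℤ) (b : Fin 2),
      γ ≤ ‖modeEigenvalue FIn FOut k b - (((FIn.density - FOut.density) / 2 : ℝ) : ℂ)‖ ∨
        k = 0 ∧ b = 1 := by
  set lam : ℂ := (((FIn.density - FOut.density) / 2 : ℝ) : ℂ) with hlam
  have hlam0 : lam ≠ 0 := by
    rw [hlam]
    exact_mod_cast div_ne_zero (sub_ne_zero.mpr hne) two_ne_zero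
  have key : ∀ b : Fin 2, ∃ γ : ℝ, 0 < γ ∧ ∀ k : Fin d → ℤ,
      γ ≤ ‖modeEigenvalue FIn FOut k b - lam‖ ∨ k = 0 ∧ b = 1 := by
    intro b
    have hlim : Tendsto (fun k => modeEigenvalue FIn FOut k b) cofinite (𝓝 0) := by
      unfold modeEigenvalue
      split_ifs
      · simpa using (FIn.tendsto_fourierCoeff.add FOut.tendsto_fourierCoeff).div_const 2
      · simpa using (FIn.tendsto_fourierCoeff.sub FOut.tendsto_fourierCoeff).div_const 2
    have hlim2 : Tendsto (fun k => ‖modeEigenvalue FIn FOut k b - lam‖) cofinite (𝓝 ‖lam‖) := by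
      simpa using (hlim.sub_const lam).norm
    have hev := hlim2.eventually (lt_mem_nhds (half_lt_self (norm_pos_iff.mpr hlam0)))
    have hfin := eventually_cofinite.mp hev
    set T := hfin.toFinset.filter fun k => ¬ (k = 0 ∧ b = 1)
    have hpos : ∀ k, ¬ (k = 0 ∧ b = 1) → 0 < ‖modeEigenvalue FIn FOut k b - lam‖ := by
      intro k hk
      rw [norm_pos_iff, sub_ne_zero]
      intro h
      unfold modeEigenvalue at h
      split_ifs at h with hb
      · refine hsum k ?_
        rw [div_eq_iff two_ne_zero] at h
        rw [h, hlam]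
        push_cast
        ring
      · have hb1 : b = 1 := by omega
        refine hdiff k (fun h0 => hk ⟨h0, hb1⟩) ?_
        rw [div_eq_iff two_ne_zero] at h
        rw [h, hlam]
        push_cast
        ring
    have hmin : ∃ γ : ℝ, 0 < γ ∧ ∀ k ∈ T, γ ≤ ‖modeEigenvalue FIn FOut k b - lam‖ := by
      rcases T.eq_empty_or_nonempty with h | h
      · exact ⟨1, one_pos, by simp [h]⟩
      · obtain ⟨k, hk, hmin⟩ := T.exists_min_image
          (fun k => ‖modeEigenvalue FIn FOut k b - lam‖) h
        exact ⟨_, hpos k (Finset.mem_filter.mp hk).2, hmin⟩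
    obtain ⟨γ, hγ, hmin⟩ := hmin
    refine ⟨min γ (‖lam‖ / 2), lt_min hγ (half_pos (norm_pos_iff.mpr hlam0)), fun k => ?_⟩
    by_cases hk : k = 0 ∧ b = 1
    · exact .inr hk
    left
    by_cases hkT : k ∈ hfin.toFinset
    · exact (min_le_left _ _).trans (hmin k (Finset.mem_filter.mpr ⟨hkT, hk⟩))
    · refine (min_le_right _ _).trans (le_of_lt ?_)
      simpa using hkT
  obtain ⟨γ0, h0, hγ0⟩ := key 0
  obtain ⟨γ1, h1, hγ1⟩ := key 1
  refine ⟨min γ0 γ1, lt_min h0 h1, fun k b => ?_⟩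
  have hb : b = 0 ∨ b = 1 := by omega
  rcases hb with rfl | rfl
  · exact (hγ0 k).imp_left (min_le_left _ _).trans
  · exact (hγ1 k).imp_left (min_le_right _ _).trans

variable (n) in
lemma sqrt_inv_mul_self : (√n : ℂ)⁻¹ * (√n : ℂ)⁻¹ = (n : ℂ)⁻¹ := by
  rw [← mul_inv, ← Complex.ofReal_mul, Real.mul_self_sqrt (Nat.cast_nonneg n)]
  simp

/-- The function for labels with signs `s, t` is `(FIn + FOut) / 2 + s t (FIn - FOut) / 2`. The
plain modes diagonalize the first summand, the signed modes the second. -/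
lemma modes_mul_diagonal_mul_conjTranspose (hn : 0 < n) (S : Finset (Fin d → ℤ))
    (σ : Labelling n) (X : Fin n → UnitAddTorus (Fin d)) (i j : Fin n) :
    (n : ℂ) * (modes S σ X *
      Matrix.diagonal (fun x : S × Fin 2 => modeEigenvalue FIn FOut x.1 x.2) *
      (modes S σ X)ᴴ) i j = (labelled FIn FOut (σ i) (σ j)).fourierSum S (X i - X j) := by
  have hn' : (n : ℂ) ≠ 0 := by exact_mod_cast hn.ne'
  rw [Matrix.mul_apply, Fintype.sum_prod_type, ConnectivityFunction.fourierSum_apply,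
    ← Finset.sum_coe_sort S, Finset.mul_sum]
  refine Finset.sum_congr rfl fun k _ => ?_
  rw [Fin.sum_univ_two, mFourier_apply_sub]
  simp only [Matrix.mul_diagonal, modes, modeEigenvalue, Matrix.conjTranspose_apply,
    Matrix.of_apply, star_mul', RCLike.star_def, map_inv₀, Complex.conj_ofReal, if_true, one_ne_zero, if_false]
  have e : ∀ a b x y D E : ℂ,
      (n : ℂ) * ((√n : ℂ)⁻¹ * ((1 : ℝ) * x) * D * ((√n : ℂ)⁻¹ * ((1 : ℝ) * y)) +
      (√n : ℂ)⁻¹ * (a * x) * E * ((√n : ℂ)⁻¹ * (b * y))) = (D + a * b * E) * (x * y) := by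
    intro a b x y D E
    have : (n : ℂ) * ((√n : ℂ)⁻¹ * (√n : ℂ)⁻¹) = 1 := by
      rw [sqrt_inv_mul_self n, mul_inv_cancel₀ hn']
    linear_combination ((1 : ℝ) * x * D * (1 : ℝ) * y + a * x * E * b * y) * this +
      (D * x * y) * (by simp : ((1 : ℝ) : ℂ) * ((1 : ℝ) : ℂ) = 1)
  rw [e]
  congr 1
  have h2 : ∀ x : Fin 2, x = 0 ∨ x = 1 := by decide
  rcases h2 (σ i) with hi | hi <;> rcases h2 (σ j) with hj | hj <;>
    simp [sign, labelled, hi, hj] <;> ring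

lemma norm_toLp_ofReal (w : Fin n → ℝ) :
    ‖toLp 2 (fun i => (w i : ℂ))‖ ^ 2 = ∑ i, w i ^ 2 := by
  rw [norm_toLp_sq]
  simp

/-- For Hermitian `M`, `‖M‖⁴ = ‖M²‖²`, which is at most the squared Frobenius norm of `M²`. The
Frobenius norm of `M` itself is in general of order `n`, too large to be compared with the gap. -/
lemma norm_map_centeredAdj_le {p : Fin n → Fin n → ℝ} (hp : ∀ i j, p i j = p j i)
    {G : SimpleGraph (Fin n)} {t : ℝ} (ht : 0 ≤ t)
    (h : ∑ i, ∑ j, (∑ k, centeredAdj p G i k * centeredAdj p G k j) ^ 2 ≤ t ^ 4) :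
    ‖(Matrix.of fun i j => (centeredAdj p G i j : ℂ) : Matrix (Fin n) (Fin n) ℂ)‖ ≤ t := by
  set M : Matrix (Fin n) (Fin n) ℂ := Matrix.of fun i j => (centeredAdj p G i j : ℂ) with hM
  have hherm : Mᴴ = M := by
    ext i j
    simp [hM, centeredAdj_comm hp G i j]
  have h1 : ‖M‖ * ‖M‖ = ‖M * M‖ := by
    rw [← Matrix.l2_opNorm_conjTranspose_mul_self, hherm]
  have h2 : ‖M * M‖ ^ 2 ≤ t ^ 4 := by
    refine (norm_matrix_sq_le_sum _).trans (le_trans (le_of_eq ?_) h)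
    refine Finset.sum_congr rfl fun i _ => Finset.sum_congr rfl fun j _ => ?_
    rw [Matrix.mul_apply]
    simp only [hM, Matrix.of_apply]
    have : ∑ k, (centeredAdj p G i k : ℂ) * (centeredAdj p G k j : ℂ) =
        ((∑ k, centeredAdj p G i k * centeredAdj p G k j : ℝ) : ℂ) := by push_cast; rfl
    rw [this, Complex.norm_real, Real.norm_eq_abs, sq_abs]
  have h3 : ‖M‖ ^ 4 ≤ t ^ 4 := by
    rw [← h1] at h2
    calc ‖M‖ ^ 4 = (‖M‖ * ‖M‖) ^ 2 := by ring
      _ ≤ t ^ 4 := h2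
  exact le_of_pow_le_pow_left₀ (by norm_num) ht h3

/-- The error of the Fourier approximation of the edge probabilities. -/
def approxError (S : Finset (Fin d → ℤ)) (σ : Labelling n) (X : Fin n → UnitAddTorus (Fin d)) :
    ℝ :=
  ∑ i, ∑ j, ‖((if i = j then 0 else edgeProbs FIn FOut σ X i j : ℝ) : ℂ) -
    (labelled FIn FOut (σ i) (σ j)).fourierSum S (X i - X j)‖ ^ 2

/-- The failure of the modes to be orthonormal. -/
def gramError (S : Finset (Fin d → ℤ)) (σ : Labelling n) (X : Fin n → UnitAddTorus (Fin d)) : ℝ :=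
  ∑ x, ∑ y, ‖((modes S σ X)ᴴ * modes S σ X - 1 : Matrix (S × Fin 2) (S × Fin 2) ℂ) x y‖ ^ 2

lemma edgeProbs_comm (σ : Labelling n) (X : Fin n → UnitAddTorus (Fin d)) (i j : Fin n) :
    edgeProbs FIn FOut σ X i j = edgeProbs FIn FOut σ X j i := by
  rw [edgeProbs, edgeProbs, edgeProb_eq, edgeProb_eq, labelled_comm,
    ← ConnectivityFunction.toFun_neg, neg_sub]

lemma edgeProbs_nonneg (σ : Labelling n) (X : Fin n → UnitAddTorus (Fin d)) (i j : Fin n) :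
    0 ≤ edgeProbs FIn FOut σ X i j := by
  rw [edgeProbs, edgeProb_eq]
  exact ConnectivityFunction.nonneg _ _

lemma edgeProbs_le_one (σ : Labelling n) (X : Fin n → UnitAddTorus (Fin d)) (i j : Fin n) :
    edgeProbs FIn FOut σ X i j ≤ 1 := by
  rw [edgeProbs, edgeProb_eq]
  exact ConnectivityFunction.le_one _ _

open Classical in
/-- The adjacency matrix is bounded away from the target eigenvalue on the orthogonal complement
of the signs of the labels. -/
lemma adjMatrix_gap (hn : 0 < n) {γ : ℝ} (hγ : 0 < γ)
    (hgap : ∀ (k : Fin d → ℤ) (b : Fin 2),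
      γ ≤ ‖modeEigenvalue FIn FOut k b - (((FIn.density - FOut.density) / 2 : ℝ) : ℂ)‖ ∨
        k = 0 ∧ b = 1)
    {c : ℝ} (hc0 : 0 ≤ c) (hc : c = |(FIn.density - FOut.density) / 2| / (8 / γ + 1))
    (S : Finset (Fin d → ℤ)) {σ : Labelling n} {X : Fin n → UnitAddTorus (Fin d)} {G : SimpleGraph (Fin n)}
    (hadj : ∑ i, ∑ j, (∑ k, centeredAdj (edgeProbs FIn FOut σ X) G i k *
      centeredAdj (edgeProbs FIn FOut σ X) G k j) ^ 2 ≤ (n * c / 4) ^ 4)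
    (happrox : approxError FIn FOut S σ X ≤ (n * c / 4) ^ 2)
    (hgram : gramError S σ X ≤ (min 1 (γ / 2)) ^ 2)
    {w : Fin n → ℝ} (hw : ∑ i, sign σ i * w i = 0) :
    (n * c / 2) ^ 2 * ∑ i, w i ^ 2 ≤
      ∑ i, ((G.adjMatrix ℝ *ᵥ w) i - (FIn.density - FOut.density) / 2 * n * w i) ^ 2 := by
  set lam := (FIn.density - FOut.density) / 2 with hlam
  set p := edgeProbs FIn FOut σ X with hp
  have hn' : (0 : ℝ) < n := by exact_mod_cast hn
  set wC : Fin n → ℂ := fun i => (w i : ℂ) with hwC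
  set U := modes S σ X with hU
  set D : S × Fin 2 → ℂ := fun x => modeEigenvalue FIn FOut x.1 x.2 with hD
  set K := U * Matrix.diagonal D * Uᴴ with hK
  set M : Matrix (Fin n) (Fin n) ℂ := Matrix.of fun i j => (centeredAdj p G i j : ℂ) with hM
  set Q : Matrix (Fin n) (Fin n) ℂ := Matrix.of fun i j =>
    ((if i = j then 0 else p i j : ℝ) : ℂ) -
      (labelled FIn FOut (σ i) (σ j)).fourierSum S (X i - X j) with hQ
  have hMn : ‖M‖ ≤ n * c / 4 :=
    norm_map_centeredAdj_le (edgeProbs_comm FIn FOut σ X) (by positivity) hadj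
  have hQn : ‖Q‖ ≤ n * c / 4 := by
    refine (sq_le_sq₀ (norm_nonneg _) (by positivity)).mp ?_
    exact (norm_matrix_sq_le_sum Q).trans happrox
  have hE : ‖Uᴴ * U - 1‖ ≤ min 1 (γ / 2) := by
    have : 0 ≤ min 1 (γ / 2) := le_min zero_le_one (by positivity)
    refine (sq_le_sq₀ (norm_nonneg _) this).mp ?_
    exact (norm_matrix_sq_le_sum _).trans hgram
  have hlow : c * ‖toLp 2 wC‖ ≤ ‖toLp 2 (K *ᵥ wC - (lam : ℂ) • wC)‖ := by
    have := mul_norm_le_norm_mulVec_sub U D (lam := (lam : ℂ)) hγ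
      (fun x => norm_modeEigenvalue_le_one FIn FOut x.1 x.2) (hE.trans (min_le_left _ _))
      (hE.trans (min_le_right _ _)) wC ?_
    · rwa [Complex.norm_real, Real.norm_eq_abs, ← hc] at this
    · intro x
      refine (hgap x.1 x.2).imp_right fun hx => ?_
      -- The exceptional mode is the normalized sign vector, to which `w` is orthogonal.
      have : ∀ i, (Uᴴ x i) * wC i = ((√n)⁻¹ * (sign σ i * w i) : ℝ) := by
        intro i
        simp [hU, modes, hwC, hx.1, hx.2, mFourier_zero, mul_assoc]
      rw [Matrix.mulVec, dotProduct]
      simp_rw [this]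
      rw [← Complex.ofReal_sum, ← Finset.mul_sum, hw]
      simp
  -- This is `A = n K + M + Q`. On the diagonal `M` vanishes and `Q` cancels `n K`.
  have hdecomp : (fun i => (((G.adjMatrix ℝ *ᵥ w) i - lam * n * w i : ℝ) : ℂ)) =
      (n : ℂ) • (K *ᵥ wC - (lam : ℂ) • wC) + (M *ᵥ wC + Q *ᵥ wC) := by
    funext i
    have hAM : ∀ j, (G.adjMatrix ℝ i j : ℂ) = n * K i j + (M i j + Q i j) := by
      intro j
      rw [hK, hD, modes_mul_diagonal_mul_conjTranspose FIn FOut hn]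
      simp only [hM, hQ, Matrix.of_apply, centeredAdj, SimpleGraph.adjMatrix_apply]
      by_cases hij : i = j
      · simp [hij]
      · simp [hij]
    simp only [Pi.add_apply, Pi.smul_apply, Pi.sub_apply, smul_eq_mul, Matrix.mulVec, dotProduct]
    push_cast
    simp_rw [hAM, add_mul, Finset.sum_add_distrib, mul_sub, Finset.mul_sum, hwC]
    have : (n : ℂ) * ((lam : ℂ) * (w i : ℂ)) = lam * n * w i := by ring
    rw [this]
    simp only [mul_assoc]
    ring
  -- The gap `n c` of `n K` loses `n c / 4` to each of `M` and `Q`.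
  have hfin : n * c / 2 * ‖toLp 2 wC‖ ≤
      ‖toLp 2 (fun i => (((G.adjMatrix ℝ *ᵥ w) i - lam * n * w i : ℝ) : ℂ))‖ := by
    rw [hdecomp, WithLp.toLp_add, WithLp.toLp_add, WithLp.toLp_smul]
    have h1 : ‖(n : ℂ) • toLp 2 (K *ᵥ wC - (lam : ℂ) • wC)‖ =
        n * ‖toLp 2 (K *ᵥ wC - (lam : ℂ) • wC)‖ := by
      rw [norm_smul]
      simp
    have h2 : n * (c * ‖toLp 2 wC‖) ≤ n * ‖toLp 2 (K *ᵥ wC - (lam : ℂ) • wC)‖ :=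
      mul_le_mul_of_nonneg_left hlow hn'.le
    have h3 : ‖toLp 2 (M *ᵥ wC) + toLp 2 (Q *ᵥ wC)‖ ≤
        n * c / 4 * ‖toLp 2 wC‖ + n * c / 4 * ‖toLp 2 wC‖ := by
      refine (norm_add_le _ _).trans (add_le_add ?_ ?_)
      · exact (norm_mulVec_le _ _).trans (mul_le_mul_of_nonneg_right hMn (norm_nonneg _))
      · exact (norm_mulVec_le _ _).trans (mul_le_mul_of_nonneg_right hQn (norm_nonneg _))
    have h4 := norm_sub_le_norm_add ((n : ℂ) • toLp 2 (K *ᵥ wC - (lam : ℂ) • wC))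
      (toLp 2 (M *ᵥ wC) + toLp 2 (Q *ᵥ wC))
    rw [h1] at h4
    linarith
  have := pow_le_pow_left₀ (by positivity) hfin 2
  rwa [mul_pow, norm_toLp_ofReal, norm_toLp_ofReal] at this

end Comparison

/-! ### Expected size of the errors caused by the positions -/

section Expectations

open scoped Matrix

variable {d : ℕ} (FIn FOut : ConnectivityFunction d) {n : ℕ}

lemma sum_sign_eq_zero {σ : Labelling n} (hσ : σ ∈ balancedLabellings n) :
    ∑ i, sign σ i = 0 := by
  have h : ∑ i, sign σ i = ((Finset.univ.filter fun i => σ i = 0).card : ℝ) -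
      (Finset.univ.filter fun i => σ i = 1).card := by
    rw [Finset.card_filter, Finset.card_filter]
    push_cast
    rw [← Finset.sum_sub_distrib]
    refine Finset.sum_congr rfl fun i _ => ?_
    have h2 : ∀ x : Fin 2, x = 0 ∨ x = 1 := by decide
    rcases h2 (σ i) with h | h <;> simp [sign, h]
  have h1 := hσ.1.trans hσ.2.symm
  rw [h, sub_eq_zero]
  exact_mod_cast Nat.eq_of_mul_eq_mul_left two_pos h1

/-- The fluctuation of the conditional mean of the degrees into the two blocks. -/
def degreeError (σ : Labelling n) (X : Fin n → UnitAddTorus (Fin d)) : ℝ :=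
  ∑ i, (∑ j ∈ Finset.univ.erase i, sign σ j * ((labelled FIn FOut (σ i) (σ j)).toFun (X i - X j)
    - (labelled FIn FOut (σ i) (σ j)).density)) ^ 2

/-- For balanced labels the mean density `(μin + μout) / 2` cancels, leaving the target eigenvalue.
The correction `FIn.density * sign σ i` is the missing loop at `i`. -/
lemma sum_sign_mul_density {σ : Labelling n} (hσ : σ ∈ balancedLabellings n) (i : Fin n) :
    ∑ j ∈ Finset.univ.erase i, sign σ j * (labelled FIn FOut (σ i) (σ j)).density =
      (FIn.density - FOut.density) / 2 * n * sign σ i - FIn.density * sign σ i := by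
  have h : ∀ j, sign σ j * (labelled FIn FOut (σ i) (σ j)).density =
      (FIn.density + FOut.density) / 2 * sign σ j +
        (FIn.density - FOut.density) / 2 * sign σ i := by
    intro j
    have h2 : ∀ x : Fin 2, x = 0 ∨ x = 1 := by decide
    rcases h2 (σ i) with hi | hi <;> rcases h2 (σ j) with hj | hj <;>
      simp [sign, labelled, hi, hj] <;> ring
  have hs := Finset.sum_erase_eq_sub (s := Finset.univ)
    (f := fun j => sign σ j * (labelled FIn FOut (σ i) (σ j)).density) (Finset.mem_univ i)
  rw [hs]
  simp_rw [h]
  rw [Finset.sum_add_distrib, ← Finset.mul_sum, sum_sign_eq_zero hσ]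
  simp
  ring

-- The residual of the sign vector splits into edge noise, position noise and the missing loops; the
-- factor `3` comes from squaring a sum of three terms.
open Classical in
lemma sum_sq_adjMatrix_mulVec_sign_le {σ : Labelling n} (hσ : σ ∈ balancedLabellings n)
    (X : Fin n → UnitAddTorus (Fin d)) (G : SimpleGraph (Fin n)) :
    ∑ i, ((G.adjMatrix ℝ *ᵥ sign σ) i - (FIn.density - FOut.density) / 2 * n * sign σ i) ^ 2 ≤
      3 * (∑ i, (∑ j, centeredAdj (edgeProbs FIn FOut σ X) G i j * sign σ j) ^ 2 +
        degreeError FIn FOut σ X + n) := by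
  have h : ∀ i, (G.adjMatrix ℝ *ᵥ sign σ) i -
      (FIn.density - FOut.density) / 2 * n * sign σ i =
      ∑ j, centeredAdj (edgeProbs FIn FOut σ X) G i j * sign σ j +
      ∑ j ∈ Finset.univ.erase i, sign σ j * ((labelled FIn FOut (σ i) (σ j)).toFun (X i - X j)
        - (labelled FIn FOut (σ i) (σ j)).density) - FIn.density * sign σ i := by
    intro i
    have e := sum_sign_mul_density FIn FOut hσ i
    simp_rw [mul_sub]
    rw [Finset.sum_sub_distrib, e, Matrix.mulVec, dotProduct,
      ← Finset.add_sum_erase _ _ (Finset.mem_univ i),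
      ← Finset.add_sum_erase _ (fun j => centeredAdj _ G i j * sign σ j) (Finset.mem_univ i)]
    have : ∑ j ∈ Finset.univ.erase i, centeredAdj (edgeProbs FIn FOut σ X) G i j * sign σ j =
        ∑ j ∈ Finset.univ.erase i, G.adjMatrix ℝ i j * sign σ j -
        ∑ j ∈ Finset.univ.erase i,
          sign σ j * (labelled FIn FOut (σ i) (σ j)).toFun (X i - X j) := by
      rw [← Finset.sum_sub_distrib]
      refine Finset.sum_congr rfl fun j hj => ?_
      simp only [centeredAdj, (Finset.ne_of_mem_erase hj).symm, if_false,
        SimpleGraph.adjMatrix_apply, edgeProbs, edgeProb_eq]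
      ring
    rw [this, centeredAdj_self, SimpleGraph.adjMatrix_apply]
    simp
    ring
  simp_rw [h, degreeError]
  rw [← Finset.sum_add_distrib, mul_add, Finset.mul_sum]
  have hn : (3 : ℝ) * n = ∑ i : Fin n, 3 := by simp [mul_comm]
  rw [hn, ← Finset.sum_add_distrib]
  refine Finset.sum_le_sum fun i _ => ?_
  have h1 : (FIn.density * sign σ i) ^ 2 ≤ 1 := by
    rw [mul_pow, sign_sq, mul_one]
    exact pow_le_one₀ FIn.density_nonneg FIn.density_le_one
  generalize ∑ j, centeredAdj (edgeProbs FIn FOut σ X) G i j * sign σ j = x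
  generalize ∑ j ∈ Finset.univ.erase i, sign σ j * ((labelled FIn FOut (σ i) (σ j)).toFun
    (X i - X j) - (labelled FIn FOut (σ i) (σ j)).density) = y
  generalize FIn.density * sign σ i = z at h1
  nlinarith [sq_nonneg (x - y), sq_nonneg (x + z), sq_nonneg (y + z)]

lemma integrable_sq_degree (σ : Labelling n) (i : Fin n) :
    Integrable (fun X : Fin n → UnitAddTorus (Fin d) => (∑ j ∈ Finset.univ.erase i,
      sign σ j * ((labelled FIn FOut (σ i) (σ j)).toFun (X i - X j)
        - (labelled FIn FOut (σ i) (σ j)).density)) ^ 2) (positions d n) := by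
  refine Integrable.of_bound (C := (n : ℝ) ^ 2) ?_ (.of_forall fun X => ?_)
  · refine Measurable.aestronglyMeasurable ((Finset.measurable_fun_sum _ fun j _ => ?_).pow_const 2)
    refine Measurable.const_mul (Measurable.sub_const ?_ _) _
    exact (labelled FIn FOut (σ i) (σ j)).measurable.comp (by fun_prop)
  · rw [norm_pow]
    refine pow_le_pow_left₀ (norm_nonneg _) ((norm_sum_le _ _).trans ?_) 2
    calc _ ≤ ∑ j ∈ Finset.univ.erase i, (1 : ℝ) := by
          refine Finset.sum_le_sum fun j _ => ?_
          rw [norm_mul, Real.norm_eq_abs, abs_sign, one_mul, Real.norm_eq_abs, abs_le]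
          set F := labelled FIn FOut (σ i) (σ j)
          constructor <;>
            linarith [F.nonneg (X i - X j), F.le_one (X i - X j), F.density_nonneg,
              F.density_le_one]
      _ ≤ n := by
          rw [Finset.sum_const, nsmul_eq_mul, mul_one]
          exact_mod_cast (Finset.card_le_univ _).trans (by simp)

lemma integrable_degreeError (σ : Labelling n) :
    Integrable (fun X : Fin n → UnitAddTorus (Fin d) => degreeError FIn FOut σ X)
      (positions d n) :=
  integrable_finsetSum _ fun i _ => integrable_sq_degree FIn FOut σ i

lemma integral_degreeError_le (σ : Labelling n) :
    ∫ X, degreeError FIn FOut σ X ∂positions d n ≤ (n : ℝ) ^ 2 := by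
  unfold degreeError
  rw [integral_finsetSum _ fun i _ => integrable_sq_degree FIn FOut σ i]
  calc _ ≤ ∑ i : Fin n, (n : ℝ) := Finset.sum_le_sum fun i _ =>
        integral_sq_sum_labelled_sub_density_le FIn FOut i σ fun j => (abs_sign σ j).le
    _ = _ := by simp [sq]

/-- The squared `L²` error of the truncated Fourier series of the connectivity functions. -/
def tailError (S : Finset (Fin d → ℤ)) : ℝ :=
  ∫ x, ‖(FIn.toFun x : ℂ) - FIn.fourierSum S x‖ ^ 2 ∂uniformTorus d +
    ∫ x, ‖(FOut.toFun x : ℂ) - FOut.fourierSum S x‖ ^ 2 ∂uniformTorus d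

lemma tendsto_tailError : Tendsto (tailError FIn FOut) atTop (𝓝 0) := by
  have h := FIn.tendsto_integral_norm_sub_fourierSum.add FOut.tendsto_integral_norm_sub_fourierSum
  rw [add_zero] at h
  exact h

lemma integral_labelled_le_tailError (S : Finset (Fin d → ℤ)) (s t : Fin 2) :
    ∫ x, ‖((labelled FIn FOut s t).toFun x : ℂ) - (labelled FIn FOut s t).fourierSum S x‖ ^ 2
      ∂uniformTorus d ≤ tailError FIn FOut S := by
  have h : ∀ F : ConnectivityFunction d,
      0 ≤ ∫ x, ‖(F.toFun x : ℂ) - F.fourierSum S x‖ ^ 2 ∂uniformTorus d :=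
    fun F => integral_nonneg fun x => sq_nonneg _
  unfold labelled tailError
  split_ifs
  · linarith [h FOut]
  · linarith [h FIn]

lemma ConnectivityFunction.norm_sq_sub_fourierSum_le (F : ConnectivityFunction d)
    (S : Finset (Fin d → ℤ)) (x : UnitAddTorus (Fin d)) :
    ‖(F.toFun x : ℂ) - F.fourierSum S x‖ ^ 2 ≤ (1 + S.card) ^ 2 :=
  pow_le_pow_left₀ (norm_nonneg _) ((norm_sub_le _ _).trans
    (add_le_add (F.norm_coe_le_one x) (F.norm_fourierSum_le S x))) 2

lemma ConnectivityFunction.measurable_norm_sq_sub_fourierSum (F : ConnectivityFunction d)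
    (S : Finset (Fin d → ℤ)) :
    Measurable fun x => ‖(F.toFun x : ℂ) - F.fourierSum S x‖ ^ 2 :=
  ((F.measurable_coe.sub (F.fourierSum S).continuous.measurable).norm).pow_const 2

/-- Off the diagonal `X i - X j` is uniform, so the mean is an `L²` truncation error on the torus.
The diagonal, where the matrix is `0` but the Fourier sum is not, costs at most the square of the
number of modes. -/
lemma integrable_integral_approx (S : Finset (Fin d → ℤ)) (σ : Labelling n) (i j : Fin n) :
    Integrable (fun X : Fin n → UnitAddTorus (Fin d) =>
      ‖((if i = j then 0 else edgeProbs FIn FOut σ X i j : ℝ) : ℂ) -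
        (labelled FIn FOut (σ i) (σ j)).fourierSum S (X i - X j)‖ ^ 2) (positions d n) ∧
    ∫ X, ‖((if i = j then 0 else edgeProbs FIn FOut σ X i j : ℝ) : ℂ) -
        (labelled FIn FOut (σ i) (σ j)).fourierSum S (X i - X j)‖ ^ 2 ∂positions d n ≤
      tailError FIn FOut S + if i = j then (S.card : ℝ) ^ 2 else 0 := by
  by_cases h : i = j
  · subst h
    simp only [if_true, sub_self, Complex.ofReal_zero, zero_sub, norm_neg]
    refine ⟨integrable_const _, ?_⟩
    have h1 := pow_le_pow_left₀ (norm_nonneg _)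
      ((labelled FIn FOut (σ i) (σ i)).norm_fourierSum_le S 0) 2
    have h2 : 0 ≤ tailError FIn FOut S :=
      (integral_nonneg fun x => sq_nonneg _).trans (integral_labelled_le_tailError FIn FOut S 0 0)
    simp only [integral_const, probReal_univ, one_smul]
    linarith
  · simp only [h, if_false, edgeProbs, edgeProb_eq, add_zero]
    set F := labelled FIn FOut (σ i) (σ j)
    have hm := F.measurable_norm_sq_sub_fourierSum S
    have hb : ∀ x, ‖‖(F.toFun x : ℂ) - F.fourierSum S x‖ ^ 2‖ ≤ (1 + S.card) ^ 2 := fun x => by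
      rw [norm_pow, norm_norm]
      exact F.norm_sq_sub_fourierSum_le S x
    refine ⟨Integrable.of_bound (C := (1 + S.card) ^ 2) ?_ (.of_forall fun X => hb _), ?_⟩
    · exact (hm.comp (by fun_prop : Measurable fun X : Fin n → UnitAddTorus (Fin d) =>
        X i - X j)).aestronglyMeasurable
    · rw [integral_comp_sub_positions h
        (g := fun x => ‖(F.toFun x : ℂ) - F.fourierSum S x‖ ^ 2) hm.stronglyMeasurable hb]
      exact integral_labelled_le_tailError FIn FOut S _ _

lemma integrable_approxError (S : Finset (Fin d → ℤ)) (σ : Labelling n) :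
    Integrable (fun X : Fin n → UnitAddTorus (Fin d) => approxError FIn FOut S σ X)
      (positions d n) :=
  integrable_finsetSum _ fun i _ => integrable_finsetSum _ fun j _ =>
    (integrable_integral_approx FIn FOut S σ i j).1

lemma integral_approxError_le (S : Finset (Fin d → ℤ)) (σ : Labelling n) :
    ∫ X, approxError FIn FOut S σ X ∂positions d n ≤
      (n : ℝ) ^ 2 * tailError FIn FOut S + n * (S.card : ℝ) ^ 2 := by
  unfold approxError
  rw [integral_finsetSum _ fun i _ => integrable_finsetSum _ fun j _ =>
    (integrable_integral_approx FIn FOut S σ i j).1]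
  simp_rw [integral_finsetSum Finset.univ fun j _ =>
    (integrable_integral_approx FIn FOut S σ _ j).1]
  calc _ ≤ ∑ i : Fin n, ∑ j : Fin n,
        (tailError FIn FOut S + if i = j then (S.card : ℝ) ^ 2 else 0) :=
        Finset.sum_le_sum fun i _ => Finset.sum_le_sum fun j _ =>
          (integrable_integral_approx FIn FOut S σ i j).2
    _ = _ := by
        simp [Finset.sum_add_distrib]
        ring

lemma conjTranspose_modes_mul_modes (S : Finset (Fin d → ℤ)) (σ : Labelling n)
    (X : Fin n → UnitAddTorus (Fin d)) (x y : S × Fin 2) :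
    ((modes S σ X)ᴴ * modes S σ X) x y = (n : ℂ)⁻¹ * ∑ i,
      (((if x.2 = 0 then 1 else sign σ i) * (if y.2 = 0 then 1 else sign σ i) : ℝ) : ℂ) *
        mFourier (y.1 - x.1 : Fin d → ℤ) (X i) := by
  rw [Matrix.mul_apply, Finset.mul_sum]
  refine Finset.sum_congr rfl fun i _ => ?_
  rw [sub_eq_add_neg, mFourier_add, mFourier_neg, ← sqrt_inv_mul_self n]
  simp only [modes, Matrix.conjTranspose_apply, Matrix.of_apply, star_mul', RCLike.star_def,
    map_inv₀, Complex.conj_ofReal]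
  push_cast
  ring

/-- For equal frequencies the Gram entries are deterministic and, by balance of the labels, exactly
those of the identity. For different frequencies they are averages of `n` uncorrelated centered
terms. -/
lemma integrable_integral_gram (hn : 0 < n) (S : Finset (Fin d → ℤ)) {σ : Labelling n}
    (hσ : σ ∈ balancedLabellings n) (x y : S × Fin 2) :
    Integrable (fun X : Fin n → UnitAddTorus (Fin d) =>
      ‖((modes S σ X)ᴴ * modes S σ X - 1 : Matrix (S × Fin 2) (S × Fin 2) ℂ) x y‖ ^ 2)
      (positions d n) ∧
    ∫ X, ‖((modes S σ X)ᴴ * modes S σ X - 1 : Matrix (S × Fin 2) (S × Fin 2) ℂ) x y‖ ^ 2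
      ∂positions d n ≤ 1 / n := by
  have hn' : (n : ℂ) ≠ 0 := by exact_mod_cast hn.ne'
  have hn0 : (0 : ℝ) < n := by exact_mod_cast hn
  set a : Fin n → ℝ := fun i => (if x.2 = 0 then 1 else sign σ i) *
    (if y.2 = 0 then 1 else sign σ i) with ha
  have ha1 : ∀ i, |a i| ≤ 1 := by
    intro i
    simp only [ha]
    split_ifs <;> simp [abs_mul, abs_sign]
  obtain ⟨k, b⟩ := x
  obtain ⟨l, e⟩ := y
  by_cases hkl : k = l
  · subst hkl
    have e0 : ∀ X : Fin n → UnitAddTorus (Fin d),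
        ‖((modes S σ X)ᴴ * modes S σ X - 1 : Matrix (S × Fin 2) (S × Fin 2) ℂ)
          (k, b) (k, e)‖ ^ 2 = 0 := by
      intro X
      have h2 : ∀ x : Fin 2, x = 0 ∨ x = 1 := by decide
      have hs : (∑ i, (sign σ i : ℂ)) = 0 := by
        rw [← Complex.ofReal_sum, sum_sign_eq_zero hσ, Complex.ofReal_zero]
      have hss : ∀ i, (sign σ i : ℂ) * (sign σ i : ℂ) = 1 := fun i => by
        rw [← Complex.ofReal_mul, ← sq, sign_sq, Complex.ofReal_one]
      rw [Matrix.sub_apply, conjTranspose_modes_mul_modes, sub_self, mFourier_zero]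
      rcases h2 b with rfl | rfl <;> rcases h2 e with rfl | rfl <;>
        simp [hn', hs, hss]
    simp_rw [e0]
    exact ⟨integrable_zero _ _ _, by simp⟩
  · have hne : ((k, b) : S × Fin 2) ≠ (l, e) := fun h => hkl (congrArg Prod.fst h)
    have hm : (l - k : Fin d → ℤ) ≠ 0 := sub_ne_zero.mpr fun h => hkl (Subtype.ext h.symm)
    have he : ∀ X : Fin n → UnitAddTorus (Fin d),
        ‖((modes S σ X)ᴴ * modes S σ X - 1 : Matrix (S × Fin 2) (S × Fin 2) ℂ)
          (k, b) (l, e)‖ ^ 2 =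
        ((n : ℝ) ^ 2)⁻¹ * ‖∑ i, (a i : ℂ) * mFourier (l - k : Fin d → ℤ) (X i)‖ ^ 2 := by
      intro X
      rw [Matrix.sub_apply, conjTranspose_modes_mul_modes, Matrix.one_apply_ne hne,
        sub_zero, norm_mul, mul_pow, norm_inv, inv_pow, Complex.norm_natCast]
    simp_rw [he]
    constructor
    · refine Integrable.of_bound (C := ((n : ℝ) ^ 2)⁻¹ * (n : ℝ) ^ 2) ?_ (.of_forall fun X => ?_)
      · exact Continuous.aestronglyMeasurable (by fun_prop)
      · rw [Real.norm_of_nonneg (by positivity)]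
        gcongr
        refine (norm_sum_le _ _).trans ?_
        calc _ ≤ ∑ i : Fin n, (1 : ℝ) := by
              refine Finset.sum_le_sum fun i _ => ?_
              rw [norm_mul, norm_mFourier_apply, mul_one, Complex.norm_real]
              exact ha1 i
          _ = n := by simp
    · rw [integral_const_mul]
      calc _ ≤ ((n : ℝ) ^ 2)⁻¹ * n :=
            mul_le_mul_of_nonneg_left (integral_norm_sq_sum_mFourier_le hm ha1) (by positivity)
        _ = 1 / n := by field_simp

lemma integrable_gramError (hn : 0 < n) (S : Finset (Fin d → ℤ)) {σ : Labelling n}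
    (hσ : σ ∈ balancedLabellings n) :
    Integrable (fun X : Fin n → UnitAddTorus (Fin d) => gramError S σ X) (positions d n) :=
  integrable_finsetSum _ fun x _ => integrable_finsetSum _ fun y _ =>
    (integrable_integral_gram hn S hσ x y).1

lemma integral_gramError_le (hn : 0 < n) (S : Finset (Fin d → ℤ)) {σ : Labelling n}
    (hσ : σ ∈ balancedLabellings n) :
    ∫ X, gramError S σ X ∂positions d n ≤ 4 * (S.card : ℝ) ^ 2 / n := by
  unfold gramError
  rw [integral_finsetSum _ fun x _ => integrable_finsetSum _ fun y _ =>
    (integrable_integral_gram hn S hσ x y).1]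
  simp_rw [integral_finsetSum Finset.univ fun y _ =>
    (integrable_integral_gram hn S hσ _ y).1]
  calc _ ≤ ∑ x : S × Fin 2, ∑ y : S × Fin 2, 1 / (n : ℝ) :=
        Finset.sum_le_sum fun x _ => Finset.sum_le_sum fun y _ =>
          (integrable_integral_gram hn S hσ x y).2
    _ = _ := by
        simp
        ring

end Expectations

/-! ### Markov's inequality for all errors at once -/

section Probability

variable {d : ℕ} (FIn FOut : ConnectivityFunction d) {n : ℕ}

/-- A bound for the probability that spectral clustering makes many errors, where `c` is the
spectral gap, `r` the tolerance for the modes, `L` controls the number of errors. -/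
def failureBound (S : Finset (Fin d → ℤ)) (c r : ℝ) (n : ℕ) (L : ℝ) : ℝ :=
  18 / L + 16 * tailError FIn FOut S / c ^ 2 +
    (512 / c ^ 4 + 16 * (S.card : ℝ) ^ 2 / c ^ 2 + 4 * (S.card : ℝ) ^ 2 / r ^ 2) / n

/-- The conditional expectation given the positions of the normalized sum of the errors. -/
def conditionalError (S : Finset (Fin d → ℤ)) (c r L : ℝ) (σ : Labelling n)
    (X : Fin n → UnitAddTorus (Fin d)) : ℝ :=
  9 / L + degreeError FIn FOut σ X / (n ^ 2 * L / 9) + 2 * (n : ℝ) ^ 3 / (n * c / 4) ^ 4 +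
    approxError FIn FOut S σ X / (n * c / 4) ^ 2 + gramError S σ X / r ^ 2

lemma integrable_conditionalError (hn : 0 < n) (S : Finset (Fin d → ℤ)) (c r L : ℝ)
    {σ : Labelling n} (hσ : σ ∈ balancedLabellings n) :
    Integrable (fun X => conditionalError FIn FOut S c r L σ X) (positions d n) :=
  ((((integrable_const _).add ((integrable_degreeError FIn FOut σ).div_const _)).add
    (integrable_const _)).add ((integrable_approxError FIn FOut S σ).div_const _)).add
    ((integrable_gramError hn S hσ).div_const _)

lemma integral_conditionalError_le (hn : 0 < n) (S : Finset (Fin d → ℤ)) {c r L : ℝ}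
    (hc : 0 < c) (hr : 0 < r) (hL : 0 < L) {σ : Labelling n} (hσ : σ ∈ balancedLabellings n) :
    ∫ X, conditionalError FIn FOut S c r L σ X ∂positions d n ≤
      failureBound FIn FOut S c r n L := by
  have hn' : (0 : ℝ) < n := by exact_mod_cast hn
  have i1 := (integrable_degreeError FIn FOut σ).div_const ((n : ℝ) ^ 2 * L / 9)
  have i2 := (integrable_approxError FIn FOut S σ).div_const ((n * c / 4) ^ 2)
  have i3 := (integrable_gramError hn S hσ).div_const (r ^ 2)
  have j1 : Integrable (fun X => 9 / L + degreeError FIn FOut σ X / (n ^ 2 * L / 9))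
    (positions d n) := (integrable_const _).add i1
  have j2 : Integrable (fun X => 9 / L + degreeError FIn FOut σ X / (n ^ 2 * L / 9) +
    2 * (n : ℝ) ^ 3 / (n * c / 4) ^ 4) (positions d n) := j1.add (integrable_const _)
  have j3 : Integrable (fun X => 9 / L + degreeError FIn FOut σ X / (n ^ 2 * L / 9) +
    2 * (n : ℝ) ^ 3 / (n * c / 4) ^ 4 + approxError FIn FOut S σ X / (n * c / 4) ^ 2)
    (positions d n) := j2.add i2
  have h1 : ∫ X, conditionalError FIn FOut S c r L σ X ∂positions d n =
      9 / L + (∫ X, degreeError FIn FOut σ X ∂positions d n) / (n ^ 2 * L / 9) +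
        2 * (n : ℝ) ^ 3 / (n * c / 4) ^ 4 +
        (∫ X, approxError FIn FOut S σ X ∂positions d n) / (n * c / 4) ^ 2 +
        (∫ X, gramError S σ X ∂positions d n) / r ^ 2 := by
    unfold conditionalError
    rw [integral_add j3 i3, integral_add j2 i2, integral_add j1 (integrable_const _),
      integral_add (integrable_const _) i1]
    simp only [integral_div, integral_const, probReal_univ, one_smul]
  rw [h1]
  -- Edge noise and position noise give `9 / L` each, hence `18 / L`. The constant `512` is `2 * 4 ^
  -- 4`, from the fourth moment.
  calc _ ≤ 9 / L + (n : ℝ) ^ 2 / (n ^ 2 * L / 9) + 2 * (n : ℝ) ^ 3 / (n * c / 4) ^ 4 +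
        ((n : ℝ) ^ 2 * tailError FIn FOut S + n * (S.card : ℝ) ^ 2) / (n * c / 4) ^ 2 +
        (4 * (S.card : ℝ) ^ 2 / n) / r ^ 2 := by
        gcongr
        · exact integral_degreeError_le FIn FOut σ
        · exact integral_approxError_le FIn FOut S σ
        · exact integral_gramError_le hn S hσ
    _ = _ := by
        unfold failureBound
        field_simp
        ring

open Classical in
/-- If all errors are small, so is the number of misclassified nodes. -/
lemma misclassified_le_of_errors_le (hn : 0 < n) {γ : ℝ} (hγ : 0 < γ)
    (hgap : ∀ (k : Fin d → ℤ) (b : Fin 2),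
      γ ≤ ‖modeEigenvalue FIn FOut k b - (((FIn.density - FOut.density) / 2 : ℝ) : ℂ)‖ ∨
        k = 0 ∧ b = 1)
    {c : ℝ} (hc0 : 0 < c) (hc : c = |(FIn.density - FOut.density) / 2| / (8 / γ + 1))
    (S : Finset (Fin d → ℤ)) {σ : Labelling n} (hσ : σ ∈ balancedLabellings n)
    {X : Fin n → UnitAddTorus (Fin d)} {L : ℝ} (hnL : 9 ≤ n * L)
    (hLn : 8 * L ≤ n * (c / 2) ^ 2) {G : SimpleGraph (Fin n)} {τ : Labelling n}
    (hτ : IsHOSCOutput FIn.density FOut.density G τ)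
    (b1 : ∑ i, (∑ j, centeredAdj (edgeProbs FIn FOut σ X) G i j * sign σ j) ^ 2 ≤ n ^ 2 * L / 9)
    (b2 : degreeError FIn FOut σ X ≤ n ^ 2 * L / 9)
    (b3 : ∑ i, ∑ j, (∑ k, centeredAdj (edgeProbs FIn FOut σ X) G i k *
      centeredAdj (edgeProbs FIn FOut σ X) G k j) ^ 2 ≤ (n * c / 4) ^ 4)
    (b4 : approxError FIn FOut S σ X ≤ (n * c / 4) ^ 2)
    (b5 : gramError S σ X ≤ (min 1 (γ / 2)) ^ 2) :
    (misclassified σ τ : ℝ) ≤ 32 / c ^ 2 * L := by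
  have hn' : (0 : ℝ) < n := by exact_mod_cast hn
  have hnn : (n : ℝ) ≤ n ^ 2 * L / 9 := by
    have := mul_le_mul_of_nonneg_left hnL hn'.le
    linarith
  have hmul : n * (8 * L) ≤ n * (n * (c / 2) ^ 2) := mul_le_mul_of_nonneg_left hLn hn'.le
  have hRκ : 8 * (n ^ 2 * L) ≤ n * (n * c / 2) ^ 2 := by
    have := mul_le_mul_of_nonneg_left hmul hn'.le
    linarith
  -- Edge noise, position noise and loops are each at most `n² L / 9`, so the residual is at most `3
  -- * 3 * n² L / 9 = n² L`.
  have h := misclassified_le_of_gap (σ := σ) hn hτ (κ := n * c / 2) (R := n ^ 2 * L)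
    (by positivity) ((sum_sq_adjMatrix_mulVec_sign_le FIn FOut hσ X G).trans (by linarith)) hRκ
    (fun w hw => adjMatrix_gap FIn FOut hn hγ hgap hc0.le hc S b3 b4 b5 hw)
  have e : 8 * (n ^ 2 * L) / (n * c / 2) ^ 2 = 32 / c ^ 2 * L := by
    field_simp
    ring
  rwa [e] at h

/-- The sum of the errors, each divided by its tolerance. -/
def normalizedError (S : Finset (Fin d → ℤ)) (c r L : ℝ) (σ : Labelling n)
    (X : Fin n → UnitAddTorus (Fin d)) (G : SimpleGraph (Fin n)) : ℝ :=
  (∑ i, (∑ j, centeredAdj (edgeProbs FIn FOut σ X) G i j * sign σ j) ^ 2) / (n ^ 2 * L / 9) +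
    degreeError FIn FOut σ X / (n ^ 2 * L / 9) +
    (∑ i, ∑ j, (∑ k, centeredAdj (edgeProbs FIn FOut σ X) G i k *
      centeredAdj (edgeProbs FIn FOut σ X) G k j) ^ 2) / (n * c / 4) ^ 4 +
    approxError FIn FOut S σ X / (n * c / 4) ^ 2 + gramError S σ X / r ^ 2

/-- Only the two terms with the centered adjacency matrix depend on the graph; the others pass
through because the weights sum to `1`. -/
lemma sum_graphWeight_mul_normalizedError_le (hn : 0 < n) (S : Finset (Fin d → ℤ)) {c r L : ℝ}
    (hL : 0 < L) (σ : Labelling n) (X : Fin n → UnitAddTorus (Fin d)) :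
    ∑ G, graphWeight (edgeProbs FIn FOut σ X) G * normalizedError FIn FOut S c r L σ X G ≤
      conditionalError FIn FOut S c r L σ X := by
  have hn' : (0 : ℝ) < n := by exact_mod_cast hn
  have hp := edgeProbs_comm FIn FOut σ X
  have hp0 := edgeProbs_nonneg FIn FOut σ X
  have hp1 := edgeProbs_le_one FIn FOut σ X
  have h1 := sum_graphWeight_mul_sum_sq_mulVec_le hp hp0 hp1 fun i => (abs_sign σ i).le
  have h2 := sum_graphWeight_mul_sum_sq_mul_self_le hp hp0 hp1
  unfold normalizedError conditionalError
  simp only [mul_add, Finset.sum_add_distrib, ← Finset.sum_mul, sum_graphWeight, one_mul,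
    ← mul_div_assoc, ← Finset.sum_div]
  have e : (n : ℝ) ^ 2 / (n ^ 2 * L / 9) = 9 / L := by field_simp
  rw [← e]
  gcongr

lemma one_le_sum_div_of_not_le {a b c e f s t u v : ℝ} (ha : 0 ≤ a) (hb : 0 ≤ b) (hc : 0 ≤ c)
    (he : 0 ≤ e) (hf : 0 ≤ f) (hs : 0 < s) (ht : 0 < t) (hu : 0 < u) (hv : 0 < v)
    (h : ¬ (a ≤ s ∧ b ≤ s ∧ c ≤ t ∧ e ≤ u ∧ f ≤ v)) :
    1 ≤ a / s + b / s + c / t + e / u + f / v := by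
  contrapose! h
  have q1 := div_nonneg ha hs.le
  have q2 := div_nonneg hb hs.le
  have q3 := div_nonneg hc ht.le
  have q4 := div_nonneg he hu.le
  have q5 := div_nonneg hf hv.le
  refine ⟨(div_le_one hs).mp ?_, (div_le_one hs).mp ?_, (div_le_one ht).mp ?_,
    (div_le_one hu).mp ?_, (div_le_one hv).mp ?_⟩ <;> linarith

/-- Given the labels and the positions, the probability of many errors is bounded by the
conditional error. -/
lemma sum_graphWeight_le_conditionalError (hn : 0 < n) {γ : ℝ} (hγ : 0 < γ)
    (hgap : ∀ (k : Fin d → ℤ) (b : Fin 2),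
      γ ≤ ‖modeEigenvalue FIn FOut k b - (((FIn.density - FOut.density) / 2 : ℝ) : ℂ)‖ ∨
        k = 0 ∧ b = 1)
    {c : ℝ} (hc0 : 0 < c) (hc : c = |(FIn.density - FOut.density) / 2| / (8 / γ + 1))
    (S : Finset (Fin d → ℤ)) {σ : Labelling n} (hσ : σ ∈ balancedLabellings n)
    (X : Fin n → UnitAddTorus (Fin d)) {L : ℝ} (hL : 0 < L) (hnL : 9 ≤ n * L)
    (hLn : 8 * L ≤ n * (c / 2) ^ 2) (B : Finset (SimpleGraph (Fin n)))
    (hB : ∀ G ∈ B, ∃ τ, IsHOSCOutput FIn.density FOut.density G τ ∧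
      32 / c ^ 2 * L < misclassified σ τ) :
    ∑ G ∈ B, graphWeight (edgeProbs FIn FOut σ X) G ≤
      conditionalError FIn FOut S c (min 1 (γ / 2)) L σ X := by
  have hn' : (0 : ℝ) < n := by exact_mod_cast hn
  have hr : 0 < min 1 (γ / 2) := lt_min one_pos (by positivity)
  have hw0 := graphWeight_nonneg (edgeProbs_nonneg FIn FOut σ X) (edgeProbs_le_one FIn FOut σ X)
  have p1 : ∀ G, 0 ≤ ∑ i, (∑ j, centeredAdj (edgeProbs FIn FOut σ X) G i j * sign σ j) ^ 2 :=
    fun G => Finset.sum_nonneg fun i _ => sq_nonneg _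
  have p2 : 0 ≤ degreeError FIn FOut σ X := Finset.sum_nonneg fun i _ => sq_nonneg _
  have p3 : ∀ G, 0 ≤ ∑ i, ∑ j, (∑ k, centeredAdj (edgeProbs FIn FOut σ X) G i k *
      centeredAdj (edgeProbs FIn FOut σ X) G k j) ^ 2 := fun G =>
    Finset.sum_nonneg fun i _ => Finset.sum_nonneg fun j _ => sq_nonneg _
  have p4 : 0 ≤ approxError FIn FOut S σ X :=
    Finset.sum_nonneg fun i _ => Finset.sum_nonneg fun j _ => sq_nonneg _
  have p5 : 0 ≤ gramError S σ X :=
    Finset.sum_nonneg fun i _ => Finset.sum_nonneg fun j _ => sq_nonneg _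
  have hΦ0 : ∀ G, 0 ≤ normalizedError FIn FOut S c (min 1 (γ / 2)) L σ X G := fun G =>
    add_nonneg (add_nonneg (add_nonneg (add_nonneg (div_nonneg (p1 G) (by positivity))
      (div_nonneg p2 (by positivity))) (div_nonneg (p3 G) (by positivity)))
      (div_nonneg p4 (by positivity))) (div_nonneg p5 (by positivity))
  have hΦ1 : ∀ G ∈ B, 1 ≤ normalizedError FIn FOut S c (min 1 (γ / 2)) L σ X G := by
    intro G hG
    refine one_le_sum_div_of_not_le (p1 G) p2 (p3 G) p4 p5 (by positivity) (by positivity)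
      (by positivity) (by positivity) ?_
    rintro ⟨b1, b2, b3, b4, b5⟩
    obtain ⟨τ, hτ, hmis⟩ := hB G hG
    exact hmis.not_ge
      (misclassified_le_of_errors_le FIn FOut hn hγ hgap hc0 hc S hσ hnL hLn hτ b1 b2 b3 b4 b5)
  -- Markov's inequality at level `1` for the nonnegative normalized error.
  calc _ ≤ ∑ G ∈ B, graphWeight (edgeProbs FIn FOut σ X) G *
        normalizedError FIn FOut S c (min 1 (γ / 2)) L σ X G :=
        Finset.sum_le_sum fun G hG => le_mul_of_one_le_right (hw0 G) (hΦ1 G hG)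
    _ ≤ ∑ G, graphWeight (edgeProbs FIn FOut σ X) G *
        normalizedError FIn FOut S c (min 1 (γ / 2)) L σ X G :=
        Finset.sum_le_univ_sum_of_nonneg fun G => mul_nonneg (hw0 G) (hΦ0 G)
    _ ≤ _ := sum_graphWeight_mul_normalizedError_le FIn FOut hn S hL σ X

end Probability

/-! ### The joint law and its disintegration -/

section Law

variable {d : ℕ} (FIn FOut : ConnectivityFunction d) {n : ℕ}

/-- With finitely many graphs this makes every set of graphs measurable, so an arbitrary algorithm
defines events. -/
instance : MeasurableSingletonClass (SimpleGraph (Fin n)) where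
  measurableSet_singleton G := by
    refine ⟨{G.Adj}, measurableSet_singleton _, ?_⟩
    ext H
    exact ⟨fun h => SimpleGraph.ext h, fun h => congrArg SimpleGraph.Adj h⟩

lemma measurable_graphProb :
    Measurable fun ω : Sample d n => graphProb FIn FOut ω.1 ω.2.1 ω.2.2 := by
  classical
  unfold graphProb
  have hX : ∀ i j, ∀ F : ConnectivityFunction d,
      Measurable fun ω : Sample d n => F.toFun (ω.2.1 i - ω.2.1 j) := fun i j F =>
    F.measurable.comp (by fun_prop)
  have hσ : ∀ i j, MeasurableSet {ω : Sample d n | ω.1 i = ω.1 j} := fun i j =>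
    measurable_fst (MeasurableSet.of_discrete (s := {σ : Labelling n | σ i = σ j}))
  have hG : ∀ i j, MeasurableSet {ω : Sample d n | ω.2.2.Adj i j} := fun i j =>
    (measurable_snd.comp measurable_snd)
      (MeasurableSet.of_discrete (s := {G : SimpleGraph (Fin n) | G.Adj i j}))
  have he : ∀ i j, Measurable fun ω : Sample d n =>
      edgeProb FIn FOut (ω.2.1 i - ω.2.1 j) (ω.1 i) (ω.1 j) := fun i j =>
    Measurable.ite (hσ i j) (hX i j FIn) (hX i j FOut)
  refine Finset.measurable_fun_prod _ fun i _ => Finset.measurable_fun_prod _ fun j _ => ?_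
  exact Measurable.ite (hG i j) (he i j) ((he i j).const_sub 1)

lemma graphProb_eq_graphWeight (σ : Labelling n) (X : Fin n → UnitAddTorus (Fin d))
    (G : SimpleGraph (Fin n)) :
    graphProb FIn FOut σ X G = graphWeight (edgeProbs FIn FOut σ X) G := rfl

lemma measurableSet_labels_graph (P : Labelling n → SimpleGraph (Fin n) → Prop) :
    MeasurableSet {ω : Sample d n | P ω.1 ω.2.2} :=
  (measurable_fst.prodMk (measurable_snd.comp measurable_snd))
    (MeasurableSet.of_discrete (s := {x : Labelling n × SimpleGraph (Fin n) | P x.1 x.2}))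

open Classical in
/-- The probability of an event that concerns the labels and the graph. -/
lemma sgbm_apply (P : Labelling n → SimpleGraph (Fin n) → Prop) :
    sgbm FIn FOut n {ω | P ω.1 ω.2.2} =
      ∫⁻ σ, ∫⁻ X, ENNReal.ofReal
        (∑ G ∈ Finset.univ.filter fun G => P σ G, graphWeight (edgeProbs FIn FOut σ X) G)
        ∂positions d n ∂ProbabilityTheory.uniformOn (balancedLabellings n) := by
  have hE := measurableSet_labels_graph (d := d) P
  have hm : Measurable fun ω : Sample d n =>
      ENNReal.ofReal (graphProb FIn FOut ω.1 ω.2.1 ω.2.2) :=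
    (measurable_graphProb FIn FOut).ennreal_ofReal
  rw [sgbm, withDensity_apply _ hE, ← lintegral_indicator hE,
    lintegral_prod _ (hm.indicator hE).aemeasurable]
  refine lintegral_congr fun σ => ?_
  have h2 : Measurable fun y : (Fin n → UnitAddTorus (Fin d)) × SimpleGraph (Fin n) =>
      Set.indicator {ω : Sample d n | P ω.1 ω.2.2}
        (fun ω => ENNReal.ofReal (graphProb FIn FOut ω.1 ω.2.1 ω.2.2)) (σ, y) :=
    (hm.indicator hE).comp measurable_prodMk_left
  rw [lintegral_prod _ h2.aemeasurable]
  refine lintegral_congr fun X => ?_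
  rw [lintegral_count, tsum_fintype, ENNReal.ofReal_sum_of_nonneg fun G _ =>
    graphWeight_nonneg (edgeProbs_nonneg FIn FOut σ X) (edgeProbs_le_one FIn FOut σ X) G,
    Finset.sum_filter]
  refine Finset.sum_congr rfl fun G _ => ?_
  simp [Set.indicator_apply, graphProb_eq_graphWeight]

/-- Conditioning on labels and positions reduces a probability bound to a pointwise bound on finite
sums of graph weights, followed by an expectation over positions, uniform in the balanced labelling.
-/
lemma sgbm_le (P : Labelling n → SimpleGraph (Fin n) → Prop) {f : Labelling n →
    (Fin n → UnitAddTorus (Fin d)) → ℝ} {b : ℝ}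
    (hf : ∀ σ ∈ balancedLabellings n, Integrable (f σ) (positions d n))
    (hb : ∀ σ ∈ balancedLabellings n, ∫ X, f σ X ∂positions d n ≤ b)
    (h : ∀ σ ∈ balancedLabellings n, ∀ X, ∀ B : Finset (SimpleGraph (Fin n)),
      (∀ G ∈ B, P σ G) → ∑ G ∈ B, graphWeight (edgeProbs FIn FOut σ X) G ≤ f σ X) :
    sgbm FIn FOut n {ω | P ω.1 ω.2.2} ≤ ENNReal.ofReal b := by
  classical
  rw [sgbm_apply]
  have hae : ∀ᵐ σ ∂ProbabilityTheory.uniformOn (balancedLabellings n),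
      ∫⁻ X, ENNReal.ofReal
        (∑ G ∈ Finset.univ.filter fun G => P σ G, graphWeight (edgeProbs FIn FOut σ X) G)
        ∂positions d n ≤ ENNReal.ofReal b := by
    filter_upwards [ProbabilityTheory.ae_cond_mem (μ := Measure.count)
      (MeasurableSet.of_discrete (s := balancedLabellings n))] with σ hσ
    -- The empty set of graphs in `h` gives nonnegativity of `f`.
    have h0 : ∀ X, 0 ≤ f σ X := fun X => by simpa using h σ hσ X ∅ (by simp)
    calc _ ≤ ∫⁻ X, ENNReal.ofReal (f σ X) ∂positions d n := by
          refine lintegral_mono fun X => ENNReal.ofReal_le_ofReal (h σ hσ X _ fun G hG => ?_)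
          exact (Finset.mem_filter.mp hG).2
      _ = ENNReal.ofReal (∫ X, f σ X ∂positions d n) :=
          (ofReal_integral_eq_lintegral_ofReal (hf σ hσ) (.of_forall h0)).symm
      _ ≤ ENNReal.ofReal b := ENNReal.ofReal_le_ofReal (hb σ hσ)
  refine (lintegral_mono_ae hae).trans ?_
  rw [lintegral_const]
  exact mul_le_of_le_one_right' prob_le_one

lemma balancedLabellings_nonempty (m : ℕ) : (balancedLabellings (2 * m)).Nonempty := by
  refine ⟨fun i => if (i : ℕ) < m then 0 else 1, ?_, ?_⟩
  · have : (Finset.univ.filter fun i : Fin (2 * m) => (i : ℕ) < m).card = m := by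
      rw [Fin.card_filter_val_lt]
      omega
    simp [this]
  · have h1 : (Finset.univ.filter fun i : Fin (2 * m) => (i : ℕ) < m).card = m := by
      rw [Fin.card_filter_val_lt]
      omega
    have h2 := Finset.card_filter_add_card_filter_not (s := Finset.univ)
      (fun i : Fin (2 * m) => (i : ℕ) < m)
    rw [h1, Finset.card_univ, Fintype.card_fin] at h2
    have : (Finset.univ.filter fun i : Fin (2 * m) => m ≤ (i : ℕ)).card = m := by
      simp only [not_lt] at h2
      omega
    simp [this]

instance (m : ℕ) : IsProbabilityMeasure (sgbm FIn FOut (2 * m)) := by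
  have := ProbabilityTheory.isProbabilityMeasure_uniformOn
    (Set.toFinite (balancedLabellings (2 * m))) (balancedLabellings_nonempty m)
  constructor
  have h := sgbm_apply FIn FOut (n := 2 * m) fun _ _ => True
  simpa [sum_graphWeight] using h

end Law

/-! ### The limit of many nodes -/

section Consistency

variable {d : ℕ} (FIn FOut : ConnectivityFunction d)

lemma tendsto_two_mul_natCast_atTop :
    Tendsto (fun m : ℕ => ((2 * m : ℕ) : ℝ)) atTop atTop :=
  tendsto_natCast_atTop_atTop.comp (tendsto_id.const_mul_atTop' two_pos)

lemma tendsto_failureBound (S : Finset (Fin d → ℤ)) (c r : ℝ) :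
    Tendsto (fun m : ℕ => failureBound FIn FOut S c r (2 * m) (Real.log ((2 * m : ℕ) : ℝ))) atTop
      (𝓝 (16 * tailError FIn FOut S / c ^ 2)) := by
  have hn := tendsto_two_mul_natCast_atTop
  have h1 := (Real.tendsto_log_atTop.comp hn).const_div_atTop 18
  have h2 := hn.const_div_atTop
    (512 / c ^ 4 + 16 * (S.card : ℝ) ^ 2 / c ^ 2 + 4 * (S.card : ℝ) ^ 2 / r ^ 2)
  simpa [failureBound] using (h1.add_const (16 * tailError FIn FOut S / c ^ 2)).add h2

lemma tendsto_log_div :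
    Tendsto (fun m : ℕ => Real.log ((2 * m : ℕ) : ℝ) / ((2 * m : ℕ) : ℝ)) atTop (𝓝 0) :=
  Real.isLittleO_log_id_atTop.tendsto_div_nhds_zero.comp tendsto_two_mul_natCast_atTop

/-- Spectral clustering misclassifies at most a multiple of `log n` nodes with high probability. -/
lemma exists_tendsto_sgbm_lt_misclassified (hne : FIn.density ≠ FOut.density)
    (hsum : ∀ k : Fin d → ℤ,
      FIn.fourierCoeff k + FOut.fourierCoeff k ≠ ((FIn.density - FOut.density : ℝ) : ℂ))
    (hdiff : ∀ k : Fin d → ℤ, k ≠ 0 →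
      FIn.fourierCoeff k - FOut.fourierCoeff k ≠ ((FIn.density - FOut.density : ℝ) : ℂ)) :
    ∃ C : ℝ, 0 < C ∧ ∀ alg : ClusteringAlgorithm, IsHOSC FIn.density FOut.density alg →
      Tendsto (fun m : ℕ => sgbm FIn FOut (2 * m)
        {ω | C * Real.log ((2 * m : ℕ) : ℝ) < misclassified ω.1 (alg m ω.2.2)}) atTop (𝓝 0) := by
  obtain ⟨γ, hγ, hgap⟩ := exists_gap FIn FOut hne hsum hdiff
  set c := |(FIn.density - FOut.density) / 2| / (8 / γ + 1) with hc
  have hc0 : 0 < c := by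
    have : 0 < |(FIn.density - FOut.density) / 2| :=
      abs_pos.mpr (div_ne_zero (sub_ne_zero.mpr hne) two_ne_zero)
    positivity
  have hr : 0 < min 1 (γ / 2) := lt_min one_pos (by positivity)
  -- This is `8 R / κ²` for `R = n² L` and `κ = n c / 2`, divided by `L`; it is chosen before the
  -- algorithm.
  refine ⟨32 / c ^ 2, by positivity, fun alg halg => ?_⟩
  rw [ENNReal.tendsto_nhds_zero]
  intro ε hε
  obtain ⟨η, hη, hηε⟩ : ∃ η : ℝ, 0 < η ∧ ENNReal.ofReal η ≤ ε := by
    rcases eq_or_ne ε ⊤ with rfl | h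
    · exact ⟨1, one_pos, le_top⟩
    · exact ⟨ε.toReal, ENNReal.toReal_pos hε.ne' h, ENNReal.ofReal_toReal_le⟩
  -- The frequencies depend on `η` but not on `n`, and the constant `32 / c ^ 2` does not depend on
  -- them.
  obtain ⟨S, hS⟩ : ∃ S, 16 * tailError FIn FOut S / c ^ 2 < η := by
    have h := ((tendsto_tailError FIn FOut).const_mul 16).div_const (c ^ 2)
    rw [mul_zero, zero_div] at h
    exact (h.eventually (gt_mem_nhds hη)).exists
  have hn := tendsto_two_mul_natCast_atTop
  have hlog := Real.tendsto_log_atTop.comp hn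
  filter_upwards [eventually_gt_atTop 0, hlog.eventually_ge_atTop 1, hn.eventually_ge_atTop 9,
    tendsto_log_div.eventually (gt_mem_nhds (show 0 < (c / 2) ^ 2 / 8 by positivity)),
    (tendsto_failureBound FIn FOut S c (min 1 (γ / 2))).eventually (gt_mem_nhds hS)]
    with m hm hL hm9 hmL hbound
  have hn0 : 0 < 2 * m := by omega
  have hn' : (0 : ℝ) < ((2 * m : ℕ) : ℝ) := by exact_mod_cast hn0
  set L := Real.log ((2 * m : ℕ) : ℝ)
  have hL1 : 1 ≤ L := hL
  have hL0 : 0 < L := one_pos.trans_le hL1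
  have hLn : 8 * L ≤ ((2 * m : ℕ) : ℝ) * (c / 2) ^ 2 := by
    have := ((div_lt_iff₀ hn').mp hmL).le
    linarith
  refine (sgbm_le FIn FOut
    (fun σ G => 32 / c ^ 2 * L < misclassified σ (alg m G))
    (fun σ hσ => integrable_conditionalError FIn FOut hn0 S c (min 1 (γ / 2)) L hσ)
    (fun σ hσ => integral_conditionalError_le FIn FOut hn0 S hc0 hr hL0 hσ)
    fun σ hσ X B hB => sum_graphWeight_le_conditionalError FIn FOut hn0 hγ hgap hc0 hc S hσ X hL0
      (by nlinarith) hLn B fun G hG => ⟨alg m G, halg m hm G, hB G hG⟩).trans ?_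
  exact (ENNReal.ofReal_le_ofReal hbound.le).trans hηε

end Consistency

end GeometricBlockModel

end

open GeometricBlockModel

theorem mainTheorem1 (d : ℕ) (FIn FOut : GeometricBlockModel.ConnectivityFunction d)
    (hne : FIn.density ≠ FOut.density)
    (hsum : ∀ k : Fin d → ℤ,
      FIn.fourierCoeff k + FOut.fourierCoeff k ≠ ((FIn.density - FOut.density : ℝ) : ℂ))
    (hdiff : ∀ k : Fin d → ℤ, k ≠ 0 →
      FIn.fourierCoeff k - FOut.fourierCoeff k ≠ ((FIn.density - FOut.density : ℝ) : ℂ)) :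
    (∀ alg : GeometricBlockModel.ClusteringAlgorithm,
      GeometricBlockModel.IsHOSC FIn.density FOut.density alg →
      GeometricBlockModel.WeaklyConsistent FIn FOut alg) ∧
    ∃ C : ℝ, 0 < C ∧ ∀ alg : GeometricBlockModel.ClusteringAlgorithm,
      GeometricBlockModel.IsHOSC FIn.density FOut.density alg →
      Tendsto (fun m : ℕ => GeometricBlockModel.sgbm FIn FOut (2 * m)
        {ω | (GeometricBlockModel.misclassified ω.1 (alg m ω.2.2) : ℝ)
          ≤ C * Real.log ((2 * m : ℕ) : ℝ)}) atTop (𝓝 1) := by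
  obtain ⟨C, hC, h⟩ := exists_tendsto_sgbm_lt_misclassified FIn FOut hne hsum hdiff
  refine ⟨fun alg halg ε hε => ?_, C, hC, fun alg halg => ?_⟩
  -- Since `log n / n` tends to `0`, eventually `C log n < ε n`, so a loss above `ε` lies in the
  -- event of more than `C log n` errors.
  · refine tendsto_of_tendsto_of_tendsto_of_le_of_le' tendsto_const_nhds (h alg halg)
      (.of_forall fun m => zero_le) ?_
    filter_upwards [eventually_gt_atTop 0,
      tendsto_log_div.eventually (gt_mem_nhds (div_pos hε hC))] with m hm hlog
    refine measure_mono fun ω hω => ?_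
    have hn' : (0 : ℝ) < ((2 * m : ℕ) : ℝ) := by exact_mod_cast (by omega : 0 < 2 * m)
    have h1 : ε * ((2 * m : ℕ) : ℝ) < misclassified ω.1 (alg m ω.2.2) := (lt_div_iff₀ hn').mp hω
    have h2 := (div_lt_div_iff₀ hn' hC).mp hlog
    exact lt_trans (by linarith) h1
  · have hcompl : ∀ m, sgbm FIn FOut (2 * m)
        {ω | (misclassified ω.1 (alg m ω.2.2) : ℝ) ≤ C * Real.log ((2 * m : ℕ) : ℝ)} =
        1 - sgbm FIn FOut (2 * m)
          {ω | C * Real.log ((2 * m : ℕ) : ℝ) < misclassified ω.1 (alg m ω.2.2)} := by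
      intro m
      rw [← prob_compl_eq_one_sub (measurableSet_labels_graph fun σ G =>
        C * Real.log ((2 * m : ℕ) : ℝ) < misclassified σ (alg m G))]
      congr 1
      ext ω
      simp
    simp_rw [hcompl]
    simpa using ENNReal.Tendsto.sub tendsto_const_nhds (h alg halg) (.inl ENNReal.one_ne_top)
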